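/- Let $H^1=H^1(\mathbb R,\mathbb C)$ with $\|f\|_{H^1}^2=\|f\|_{L^2}^2+\|f'\|_{L^2}^2$, and put $\langle f,g\rangle=\operatorname{Re}\int_{\mathbb R} f\bar g\,dx$, $\omega(f,g)=\operatorname{Im}\int_{\mathbb R} f\bar g\,dx$. For real $q$ and $\lambda>|q|$ let $$v_{\lambda}(x)=v_{\lambda,q}(x)=\lambda\operatorname{sech}\bigl(\lambda|x|+\tanh^{-1}(q/\lambda)\bigr),$$ and write $v=v_{1}$ and $\partial_\lambda v=\partial_\lambda v_{\lambda}|_{\lambda=1}$. Define $$P_qf=\omega(f,\partial_\lambda v)\,iv-\omega(f,iv)\,\partial_\lambda v .$$ Let $\mathcal L_q=\begin{bmatrix}L_{q+}&0\\0&L_{q-}\end{bmatrix}$, acting on $f\simeq(\operatorname{Re}f,\operatorname{Im}f)$, where $$L_{q+}=\tfrac12\bigl(1-\partial_x^2-6v^2-2q\delta_0\bigr),\qquad L_{q-}=\tfrac12\bigl(1-\partial_x^2-2v^2-2q\delta_0\bigr);$$ for $f\in H^1$ the expression $\langle\mathcal L_qf,f\rangle$ is understood as the quadratic form, that is, with $f_1=\operatorname{Re}f$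 and $f_2=\operatorname{Im}f$, $$\langle\mathcal L_qf,f\rangle=\tfrac12\int_{\mathbb R}\bigl(|f'|^2+|f|^2-6v^2f_1^2-2v^2f_2^2\bigr)dx-q\,|f(0)|^2 .$$ Lemma (Coercivity). There exist $c_0>0$ and $q_0\in(0,1)$ such that for every real $q$ with $|q|<q_0$ and every even $f\in H^1$ with $P_qf=0$, $$\|f\|_{H^1}^2\le c_0\,\langle\mathcal L_qf,f\rangle .$$ In particular $c_0$ does not depend on $q$ or $f$. -/

import Mathlib

open MeasureTheory
open scoped ContDiff

noncomputable section

namespace DeltaNLS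

/-- `g` is a weak (distributional) derivative of `f` on `ℝ`:
`∫ φ' f = - ∫ φ g` for every smooth, compactly supported, real test function `φ`. -/
def IsWeakDeriv {E : Type*} [NormedAddCommGroup E] [NormedSpace ℝ E] (f g : ℝ → E) : Prop :=
  ∀ φ : ℝ → ℝ, ContDiff ℝ ∞ φ → HasCompactSupport φ →
    ∫ x, deriv φ x • f x = -∫ x, φ x • g x

/-- `f ∈ H¹(ℝ, E)`: `f` is square integrable with a square integrable weak derivative.
Every class in `H¹(ℝ)` has exactly one continuous representative; `f` is that representative, so
that the point value `f 0` is the trace of the class at `0`. -/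
def MemH1 {E : Type*} [NormedAddCommGroup E] [NormedSpace ℝ E] (f : ℝ → E) : Prop :=
  Continuous f ∧ MemLp f 2 volume ∧ ∃ g : ℝ → E, MemLp g 2 volume ∧ IsWeakDeriv f g

open Classical in
/-- A square integrable weak derivative of `f` (unique up to null sets), and `0` if there is
none. -/
def weakDeriv {E : Type*} [NormedAddCommGroup E] [NormedSpace ℝ E] (f : ℝ → E) : ℝ → E :=
  if h : ∃ g : ℝ → E, MemLp g 2 volume ∧ IsWeakDeriv f g then h.choose else 0

theorem MemH1.weakDeriv_spec {E : Type*} [NormedAddCommGroup E] [NormedSpace ℝ E] {f : ℝ → E}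
    (hf : MemH1 f) : MemLp (weakDeriv f) 2 volume ∧ IsWeakDeriv f (weakDeriv f) := by
  have h := hf.2.2
  rw [weakDeriv, dif_pos h]
  exact h.choose_spec

/-- Two square integrable weak derivatives of the same function agree almost everywhere. -/
theorem IsWeakDeriv.ae_eq {E : Type*} [NormedAddCommGroup E] [NormedSpace ℝ E] [CompleteSpace E]
    {f g h : ℝ → E}
    (hg : IsWeakDeriv f g) (hh : IsWeakDeriv f h) (hg2 : MemLp g 2 volume)
    (hh2 : MemLp h 2 volume) : g =ᵐ[volume] h := by
  refine ae_eq_of_integral_contDiff_smul_eq (hg2.locallyIntegrable (by norm_num))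
    (hh2.locallyIntegrable (by norm_num)) fun φ hφ hφc => ?_
  have := (hg φ hφ hφc).symm.trans (hh φ hφ hφc)
  exact neg_injective this

/-- `‖f‖_{H¹}² = ‖f‖_{L²}² + ‖f'‖_{L²}²`. -/
def h1NormSq {E : Type*} [NormedAddCommGroup E] [NormedSpace ℝ E] (f : ℝ → E) : ℝ :=
  (∫ x, ‖f x‖ ^ 2) + ∫ x, ‖weakDeriv f x‖ ^ 2

/-- The nonlinear ground state `v_{λ,q}(x) = λ sech(λ|x| + artanh(q/λ))`, for `|q| < λ`. -/
def groundState (lam q x : ℝ) : ℝ :=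
  lam / Real.cosh (lam * |x| + Real.artanh (q / lam))

/-- `∂_λ v_{λ,q}(x)`. -/
def dGroundState (lam q x : ℝ) : ℝ :=
  deriv (fun mu : ℝ => groundState mu q x) lam

/-- The symplectic form `ω(f, g) = Im ∫ f ḡ`. -/
def omega (f g : ℝ → ℂ) : ℝ :=
  (∫ x, f x * (starRingEnd ℂ) (g x)).im

/-- The projection `P_{λ,q} f = ω(f, ∂_λ v) i v - ω(f, i v) ∂_λ v`, where `v = v_{λ,q}`. -/
def proj (lam q : ℝ) (f : ℝ → ℂ) : ℝ → ℂ := fun x =>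
  (omega f (fun y => (dGroundState lam q y : ℂ)) : ℂ) * (Complex.I * (groundState lam q x : ℂ))
    - (omega f (fun y => Complex.I * (groundState lam q y : ℂ)) : ℂ) * (dGroundState lam q x : ℂ)

/-- The pairing `⟨½(λ² - ∂ₓ² - k v² - 2 q δ₀) u, w⟩` of `H⁻¹(ℝ)` with `H¹(ℝ)` for real-valued
`u, w ∈ H¹(ℝ)`, where `v = v_{λ,q}`:
`½ (λ² ∫ u w + ∫ u' w' - k ∫ v² u w - 2 q u(0) w(0))`. -/
def scalarPairing (k lam q : ℝ) (u w : ℝ → ℝ) : ℝ :=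
  (1 / 2) * (lam ^ 2 * (∫ x, u x * w x) + (∫ x, weakDeriv u x * weakDeriv w x)
    - k * (∫ x, groundState lam q x ^ 2 * (u x * w x)) - 2 * q * (u 0 * w 0))

/-- `⟨L_{q+} u, w⟩` with `L_{q+} = ½(λ² - ∂ₓ² - 6 v² - 2 q δ₀)`. -/
def LPlusPairing (lam q : ℝ) (u w : ℝ → ℝ) : ℝ := scalarPairing 6 lam q u w

/-- `⟨L_{q-} u, w⟩` with `L_{q-} = ½(λ² - ∂ₓ² - 2 v² - 2 q δ₀)`. -/
def LMinusPairing (lam q : ℝ) (u w : ℝ → ℝ) : ℝ := scalarPairing 2 lam q u w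

/-- `⟨𝓛_q f, g⟩` for `f, g ∈ H¹(ℝ, ℂ)`, where `𝓛_q = diag(L_{q+}, L_{q-})` acts from
`H¹(ℝ, ℂ) ≃ H¹(ℝ, ℝ) ⊕ H¹(ℝ, ℝ)`, `f ≃ (Re f, Im f)`, to its dual, and `⟨·,·⟩` extends the real
inner product `Re ∫ f ḡ = ∫ Re f Re g + ∫ Im f Im g`. -/
def LPairing (lam q : ℝ) (f g : ℝ → ℂ) : ℝ :=
  LPlusPairing lam q (fun x => (f x).re) (fun x => (g x).re)
    + LMinusPairing lam q (fun x => (f x).im) (fun x => (g x).im)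

end DeltaNLS

end

open MeasureTheory Set Filter Topology
open scoped ContDiff

namespace DeltaNLS

/-! Real and imaginary parts of `P_q f = 0` at `x = 0`, where `v` and `∂_λ v` are both nonzero, give
`Re f ⊥ v` and `Im f ⊥ ∂_λ v`. The form decouples as well, and evenness reduces it to a half-line,
where `v = sech (x + a)` with `tanh a = q` is smooth and the delta becomes a boundary term `-q
f(0)²`. There `T = tanh (x + a)` stays in `[-1/10, 1)`, so completing squares with `T` as a
parameter gives explicit constants uniform in `q`, with no compactness or perturbation argument.

For `L₋`: since `v' = -T v`, the form is exactly `∫ h²` with `h = f' + T f`, which vanishes only on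
multiples of `v`. Orthogonality to `∂_λ v` bounds `f(0)²` by `∫ h²`, because `∫_0^∞ v ∂_λ v = 1/2`
for all `q`; then the weight `(2 - T) f²` bounds `∫ f²` (`halfLine_minus_coercive`).

For `L₊`, which has a negative direction, the constraint is carried as a second state `z = -v⁻¹
∫_0^x f v`: `z' = T z - f`, `z(0) = 0`, and `f ⊥ v` forces `z → 0`. A solution of the Riccati
equation for `(f, z)` turns the form into `∫ h² + (1 + q) f(0)²`, with `h` now the corresponding
first-order expression in `f', f, z`. A Lyapunov function for the flow `h = 0` then bounds `∫ f²`
(`lyapunov_deriv_le`, `halfLine_plus_coercive`). -/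

/-! ### Weak derivatives and absolute continuity on the line -/

theorem exists_forall_le_abs_eq_zero {ψ : ℝ → ℝ} (hc : HasCompactSupport ψ) :
    ∃ R : ℝ, 0 < R ∧ ∀ x, R ≤ |x| → ψ x = 0 := by
  obtain ⟨R, hR⟩ := hc.isCompact.isBounded.subset_closedBall (0 : ℝ)
  refine ⟨|R| + 1, by positivity, fun x hx => ?_⟩
  by_contra h
  have := hR (subset_tsupport _ h)
  simp only [Metric.mem_closedBall, dist_zero_right, Real.norm_eq_abs] at this
  linarith [le_abs_self R]

theorem integral_eq_intervalIntegral_of_forall_eq_zero {u : ℝ → ℝ} {R x : ℝ}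
    (hu : ∀ x, R ≤ |x| → u x = 0) (hx : R ≤ x) : ∫ t, u t = ∫ t in (-R)..x, u t := by
  rw [intervalIntegral.integral_eq_integral_of_support_subset]
  intro t ht
  have h := abs_lt.1 (not_le.1 fun h => ht (hu t h))
  exact ⟨h.1, by linarith [h.2]⟩

/-- Zero mean is what makes the primitive from the left vanish again to the right of the support. -/
theorem exists_primitive_of_integral_eq_zero {ψ : ℝ → ℝ} (hψ : ContDiff ℝ ∞ ψ)
    (hc : HasCompactSupport ψ) (h0 : ∫ x, ψ x = 0) :
    ∃ φ : ℝ → ℝ, ContDiff ℝ ∞ φ ∧ HasCompactSupport φ ∧ deriv φ = ψ := by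
  obtain ⟨R, hR0, hR⟩ := exists_forall_le_abs_eq_zero hc
  have hd : ∀ x, HasDerivAt (fun x => ∫ t in (-R)..x, ψ t) (ψ x) x := fun x =>
    intervalIntegral.integral_hasDerivAt_right (hψ.continuous.intervalIntegrable _ _)
      hψ.continuous.stronglyMeasurable.stronglyMeasurableAtFilter hψ.continuous.continuousAt
  have hd' : deriv (fun x => ∫ t in (-R)..x, ψ t) = ψ := funext fun x => (hd x).deriv
  refine ⟨fun x => ∫ t in (-R)..x, ψ t, ?_, ?_, hd'⟩
  · rw [contDiff_infty_iff_deriv, hd']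
    exact ⟨fun x => (hd x).differentiableAt, hψ⟩
  · refine HasCompactSupport.intro (isCompact_Icc (a := -R) (b := R)) fun x hx => ?_
    have hRx : R < |x| := by
      rw [mem_Icc, ← abs_le] at hx
      exact not_le.1 hx
    rcases le_or_gt 0 x with h | h
    · rw [abs_of_nonneg h] at hRx
      rw [← integral_eq_intervalIntegral_of_forall_eq_zero hR hRx.le, h0]
    · rw [abs_of_neg h] at hRx
      rw [intervalIntegral.integral_symm, neg_eq_zero]
      apply intervalIntegral.integral_zero_ae
      refine Eventually.of_forall fun t ht => hR t ?_
      rw [uIoc_of_le (by linarith)] at ht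
      rw [abs_of_nonpos (by linarith [ht.2])]
      linarith [ht.2]

/-- The lemma of du Bois-Reymond for continuous functions. -/
theorem eq_of_integral_deriv_mul_eq_zero {u : ℝ → ℝ} (hu : Continuous u)
    (h : ∀ φ : ℝ → ℝ, ContDiff ℝ ∞ φ → HasCompactSupport φ → ∫ x, deriv φ x * u x = 0)
    (a b : ℝ) : u a = u b := by
  let B : ContDiffBump (0 : ℝ) := ⟨1, 2, one_pos, one_lt_two⟩
  set η : ℝ → ℝ := B.normed volume with hη
  have hηd : ContDiff ℝ ∞ η := B.contDiff_normed
  have hηc : HasCompactSupport η := B.hasCompactSupport_normed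
  have hη1 : ∫ x, η x = 1 := B.integral_normed
  have hint : ∀ {φ w : ℝ → ℝ}, Continuous φ → HasCompactSupport φ → Continuous w →
      Integrable (fun x => φ x * w x) := fun {φ w} h1 h2 h3 =>
    (h1.mul h3).integrable_of_hasCompactSupport h2.mul_right
  set c := ∫ x, η x * u x with hcdef
  have key : ∀ᵐ x, u x = c := by
    refine ae_eq_of_integral_contDiff_smul_eq hu.locallyIntegrable
      continuous_const.locallyIntegrable fun φ hφ hφc => ?_
    set m := ∫ x, φ x with hm
    have hφi : Integrable φ := hφ.continuous.integrable_of_hasCompactSupport hφc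
    have hηi : Integrable η := hηd.continuous.integrable_of_hasCompactSupport hηc
    -- Subtracting `m * η` removes the mean of `φ`, so what is left is the derivative of a test
    -- function.
    obtain ⟨χ, hχ, hχc, hχd⟩ := exists_primitive_of_integral_eq_zero
      (ψ := fun x => φ x - m * η x) (hφ.sub (contDiff_const.mul hηd))
      (by
        have he : (fun x => φ x - m * η x) = φ + (fun _ => -m) * η := by
          funext x
          simp only [Pi.add_apply, Pi.mul_apply]
          ring
        rw [he]
        exact hφc.add (hηc.mul_left (f := fun _ => -m))) (by
        rw [integral_sub hφi (hηi.const_mul m), integral_const_mul, hη1, ← hm]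
        ring)
    have h1 := h χ hχ hχc
    rw [hχd] at h1
    have h2 : ∀ x, (φ x - m * η x) * u x = φ x * u x - m * (η x * u x) := fun x => by ring
    simp_rw [h2] at h1
    rw [integral_sub (hint hφ.continuous hφc hu)
      ((hint hηd.continuous hηc hu).const_mul m), integral_const_mul, ← hcdef] at h1
    simp only [smul_eq_mul]
    rw [integral_mul_const, ← hm]
    linarith
  have : u = fun _ => c := Continuous.ae_eq_iff_eq volume hu continuous_const |>.1 key
  rw [this]

theorem intervalIntegrable_of_memLp_two {g : ℝ → ℝ} (hg : MemLp g 2 volume) (a b : ℝ) :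
    IntervalIntegrable g volume a b :=
  intervalIntegrable_iff.2 <| ((hg.locallyIntegrable (by norm_num)).integrableOn_isCompact
    isCompact_uIcc).mono_set uIoc_subset_uIcc

theorem absolutelyContinuousOnInterval_of_eq_integral {f g : ℝ → ℝ} (hg : MemLp g 2 volume)
    (hfg : ∀ x, f x = f 0 + ∫ t in (0 : ℝ)..x, g t) {a b : ℝ} :
    AbsolutelyContinuousOnInterval f a b := by
  have h1 : AbsolutelyContinuousOnInterval (fun x => ∫ t in a..x, g t) a b :=
    (intervalIntegrable_of_memLp_two hg a b).absolutelyContinuousOnInterval_intervalIntegral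
      (by simp)
  have h2 : AbsolutelyContinuousOnInterval (fun _ : ℝ => f a) a b :=
    contDiffOn_const.absolutelyContinuousOnInterval
  have h3 : f = (fun _ : ℝ => f a) + fun x => ∫ t in a..x, g t := by
    funext x
    simp only [Pi.add_apply]
    rw [hfg x, hfg a, add_assoc, intervalIntegral.integral_add_adjacent_intervals
      (intervalIntegrable_of_memLp_two hg _ _) (intervalIntegrable_of_memLp_two hg _ _)]
  rw [h3]
  exact h2.add h1

theorem ae_hasDerivAt_of_eq_integral {f g : ℝ → ℝ} (hg : MemLp g 2 volume)
    (hfg : ∀ x, f x = f 0 + ∫ t in (0 : ℝ)..x, g t) : ∀ᵐ x, HasDerivAt f (g x) x := by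
  filter_upwards [LocallyIntegrable.ae_hasDerivAt_integral
    (hg.locallyIntegrable (by norm_num))] with x hx
  have h := (hx 0).const_add (f 0)
  rwa [show f = fun x => f 0 + ∫ t in (0 : ℝ)..x, g t from funext hfg]

theorem integral_eq_sub_of_absolutelyContinuousOnInterval {f f' : ℝ → ℝ} {a b : ℝ}
    (hf : AbsolutelyContinuousOnInterval f a b) (h : ∀ᵐ x, HasDerivAt f (f' x) x) :
    ∫ x in a..b, f' x = f b - f a := by
  rw [← hf.integral_deriv_eq_sub]
  refine intervalIntegral.integral_congr_ae ?_
  filter_upwards [h] with x hx _ using hx.deriv.symm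

/-- A continuous function with square integrable weak derivative is the integral of it. -/
theorem IsWeakDeriv.eq_integral {f g : ℝ → ℝ} (hf : Continuous f) (hg : MemLp g 2 volume)
    (h : IsWeakDeriv f g) (x : ℝ) : f x = f 0 + ∫ t in (0 : ℝ)..x, g t := by
  set G : ℝ → ℝ := fun x => ∫ t in (0 : ℝ)..x, g t with hG
  have hG' : ∀ x, G x = G 0 + ∫ t in (0 : ℝ)..x, g t := fun x => by simp [hG]
  have hGc : Continuous G :=
    intervalIntegral.continuous_primitive (intervalIntegrable_of_memLp_two hg) 0
  -- Integration by parts shows that `G` also has weak derivative `g`, so `f - G` is constant.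
  have key := eq_of_integral_deriv_mul_eq_zero (hf.sub hGc) (fun φ hφ hφc => ?_) x 0
  · simp only [Pi.sub_apply, hG, intervalIntegral.integral_same] at key
    linarith
  have hφ' : Continuous (deriv φ) := hφ.continuous_deriv (by simp)
  have hi : ∀ {w : ℝ → ℝ}, Continuous w → Integrable (fun x => deriv φ x * w x) := fun {w} hw =>
    (hφ'.mul hw).integrable_of_hasCompactSupport hφc.deriv.mul_right
  simp only [Pi.sub_apply, mul_sub]
  rw [integral_sub (hi hf) (hi hGc)]
  have h1 := h φ hφ hφc
  simp only [smul_eq_mul] at h1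
  rw [h1]
  obtain ⟨R₁, -, hR₁⟩ := exists_forall_le_abs_eq_zero hφc
  obtain ⟨R₂, -, hR₂⟩ := exists_forall_le_abs_eq_zero hφc.deriv
  obtain ⟨R, hR1, hR2, hR0⟩ : ∃ R, R₁ ≤ R ∧ R₂ ≤ R ∧ 0 ≤ R :=
    ⟨max (max R₁ R₂) 0, by simp, by simp, by simp⟩
  have hz1 : ∀ x, R ≤ |x| → φ x = 0 := fun x hx => hR₁ x (hR1.trans hx)
  have hz2 : ∀ x, R ≤ |x| → deriv φ x = 0 := fun x hx => hR₂ x (hR2.trans hx)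
  rw [integral_eq_intervalIntegral_of_forall_eq_zero (u := fun x => φ x * g x) (R := R)
      (fun x hx => by simp [hz1 x hx]) le_rfl,
    integral_eq_intervalIntegral_of_forall_eq_zero (u := fun x => deriv φ x * G x) (R := R)
      (fun x hx => by simp [hz2 x hx]) le_rfl]
  have hφac : AbsolutelyContinuousOnInterval φ (-R) R :=
    (hφ.of_le (by simp)).contDiffOn.absolutelyContinuousOnInterval
  have hGac : AbsolutelyContinuousOnInterval G (-R) R :=
    absolutelyContinuousOnInterval_of_eq_integral hg hG'
  have h2 := hφac.integral_mul_deriv_eq_deriv_mul hGac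
  rw [hz1 R (le_abs_self R), hz1 (-R) (by rw [abs_neg]; exact le_abs_self R)] at h2
  have h3 : ∫ x in (-R)..R, φ x * deriv G x = ∫ x in (-R)..R, φ x * g x := by
    refine intervalIntegral.integral_congr_ae ?_
    filter_upwards [ae_hasDerivAt_of_eq_integral hg hG'] with x hx _
    rw [hx.deriv]
  rw [h3] at h2
  rw [h2]
  ring

theorem integrable_mul_of_memLp_two {f g : ℝ → ℝ} {μ : Measure ℝ} (hf : MemLp f 2 μ)
    (hg : MemLp g 2 μ) : Integrable (fun x => f x * g x) μ :=
  hf.integrable_mul hg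

/-- Functions in `H¹` vanish at infinity. -/
theorem tendsto_atTop_zero_of_eq_integral {f g : ℝ → ℝ} (hf : MemLp f 2 volume)
    (hg : MemLp g 2 volume) (hfg : ∀ x, f x = f 0 + ∫ t in (0 : ℝ)..x, g t) :
    Tendsto f atTop (𝓝 0) := by
  -- `(f²)' = 2 f g` is integrable, so `f²` has a limit at infinity; integrability of `f²` forces
  -- that limit to be 0.
  have hfg2 : Integrable (fun x => 2 * (f x * g x)) :=
    (integrable_mul_of_memLp_two hf hg).const_mul 2
  have h1 : ∀ R, ∫ x in (0 : ℝ)..R, 2 * (f x * g x) = f R * f R - f 0 * f 0 := fun R => by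
    have hac := absolutelyContinuousOnInterval_of_eq_integral hg hfg (a := 0) (b := R)
    refine integral_eq_sub_of_absolutelyContinuousOnInterval (hac.fun_mul hac) ?_
    filter_upwards [ae_hasDerivAt_of_eq_integral hg hfg] with x hx
    exact (hx.fun_mul hx).congr_deriv (by ring)
  have h2 : Tendsto (fun R => f R * f R) atTop
      (𝓝 (f 0 * f 0 + ∫ x in Ioi (0 : ℝ), 2 * (f x * g x))) := by
    have h := (intervalIntegral_tendsto_integral_Ioi 0 hfg2.integrableOn tendsto_id).const_add
      (f 0 * f 0)
    refine h.congr fun R => ?_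
    simp only [id, h1]
    abel
  have h3 : IntegrableAtFilter (fun R => f R * f R) atTop :=
    ⟨univ, univ_mem, (integrable_mul_of_memLp_two hf hf).integrableOn⟩
  have h4 := h3.eq_zero_of_tendsto (fun s hs => by
    rcases mem_atTop_sets.1 hs with ⟨b, hb⟩
    rw [← top_le_iff, ← Real.volume_Ici (a := b)]
    exact measure_mono hb) h2
  rw [h4] at h2
  have h5 := (Real.continuous_sqrt.tendsto 0).comp h2
  rw [Real.sqrt_zero] at h5
  rw [tendsto_zero_iff_abs_tendsto_zero]
  refine h5.congr fun R => ?_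
  simp [Real.sqrt_mul_self_eq_abs]

/-! ### Shifted hyperbolic functions and calculus on the half-line -/

/-- `sech (x + a)`. -/
noncomputable def sechShift (a x : ℝ) : ℝ := 1 / Real.cosh (x + a)

/-- `tanh (x + a)`. -/
noncomputable def tanhShift (a x : ℝ) : ℝ := Real.tanh (x + a)

theorem sechShift_pos (a x : ℝ) : 0 < sechShift a x := one_div_pos.2 (Real.cosh_pos _)

theorem sechShift_le_one (a x : ℝ) : sechShift a x ≤ 1 :=
  (div_le_one (Real.cosh_pos _)).2 (Real.one_le_cosh _)

theorem sechShift_sq (a x : ℝ) : sechShift a x ^ 2 = 1 - tanhShift a x ^ 2 := by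
  have h := (Real.cosh_pos (x + a)).ne'
  have h2 := Real.cosh_sq (x + a)
  rw [sechShift, tanhShift, Real.tanh_eq_sinh_div_cosh]
  field_simp
  linarith

theorem hasDerivAt_sechShift (a x : ℝ) :
    HasDerivAt (sechShift a) (-(tanhShift a x * sechShift a x)) x := by
  have h := (Real.cosh_pos (x + a)).ne'
  have h1 := (((hasDerivAt_id x).add_const a).cosh).inv h
  have h2 : sechShift a = fun x => (Real.cosh (id x + a))⁻¹ := by
    funext y
    simp [sechShift]
  rw [h2]
  refine h1.congr_deriv ?_
  rw [tanhShift, Real.tanh_eq_sinh_div_cosh]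
  simp only [id]
  field_simp

theorem hasDerivAt_tanhShift (a x : ℝ) :
    HasDerivAt (tanhShift a) (1 - tanhShift a x ^ 2) x := by
  have h := (Real.cosh_pos (x + a)).ne'
  have h0 := (hasDerivAt_id x).add_const a
  have h1 := (h0.sinh).div (h0.cosh) h
  have h2 : tanhShift a = fun x => Real.sinh (id x + a) / Real.cosh (id x + a) := by
    funext y
    simp [tanhShift, Real.tanh_eq_sinh_div_cosh]
  rw [h2]
  refine h1.congr_deriv ?_
  simp only [id]
  field_simp

theorem continuous_sechShift (a : ℝ) : Continuous (sechShift a) :=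
  continuous_iff_continuousAt.2 fun x => (hasDerivAt_sechShift a x).continuousAt

theorem continuous_tanhShift (a : ℝ) : Continuous (tanhShift a) :=
  continuous_iff_continuousAt.2 fun x => (hasDerivAt_tanhShift a x).continuousAt

theorem absolutelyContinuousOnInterval_of_hasDerivAt {F F' : ℝ → ℝ}
    (h : ∀ x, HasDerivAt F (F' x) x) (hc : Continuous F') {a b : ℝ} :
    AbsolutelyContinuousOnInterval F a b := by
  have h1 : ContDiff ℝ 1 F := by
    rw [contDiff_one_iff_deriv, show deriv F = F' from funext fun x => (h x).deriv]
    exact ⟨fun x => (h x).differentiableAt, hc⟩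
  exact h1.contDiffOn.absolutelyContinuousOnInterval

theorem absolutelyContinuousOnInterval_tanhShift (s a b : ℝ) :
    AbsolutelyContinuousOnInterval (tanhShift s) a b :=
  absolutelyContinuousOnInterval_of_hasDerivAt (hasDerivAt_tanhShift s)
    (continuous_const.sub ((continuous_tanhShift s).pow 2))

theorem absolutelyContinuousOnInterval_const (c a b : ℝ) :
    AbsolutelyContinuousOnInterval (fun _ => c) a b :=
  contDiffOn_const.absolutelyContinuousOnInterval

theorem tanhShift_lt_one (a x : ℝ) : tanhShift a x < 1 := Real.tanh_lt_one _

theorem neg_one_lt_tanhShift (a x : ℝ) : -1 < tanhShift a x := Real.neg_one_lt_tanh _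

theorem tanhShift_zero (a : ℝ) : tanhShift a 0 = Real.tanh a := by simp [tanhShift]

theorem tanh_le_tanhShift {a x : ℝ} (hx : 0 ≤ x) : Real.tanh a ≤ tanhShift a x := by
  rw [← tanhShift_zero a]
  refine monotone_of_deriv_nonneg (fun y => (hasDerivAt_tanhShift a y).differentiableAt)
    (fun y => ?_) hx
  rw [(hasDerivAt_tanhShift a y).deriv, ← sechShift_sq]
  positivity

/-- `e^{2a} = (1 + t) / (1 - t)` with `t = tanh a`; the bound 2 is crude, only uniformity in `q`
matters. -/
theorem exp_le_two_of_tanh_le {a : ℝ} (h : Real.tanh a ≤ 1 / 10) : Real.exp a ≤ 2 := by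
  rw [Real.tanh_eq_sinh_div_cosh, div_le_iff₀ (Real.cosh_pos a), Real.sinh_eq, Real.cosh_eq,
    Real.exp_neg] at h
  have h1 := Real.exp_pos a
  by_contra! h2
  have h3 : (Real.exp a)⁻¹ ≤ 1 / 2 := by
    rw [inv_le_comm₀ h1 (by norm_num)]
    linarith
  linarith

theorem exp_neg_le_two_of_le_tanh {a : ℝ} (h : -(1 / 10) ≤ Real.tanh a) : Real.exp (-a) ≤ 2 :=
  exp_le_two_of_tanh_le (by rw [Real.tanh_neg]; linarith)

theorem sechShift_le (a x : ℝ) : sechShift a x ≤ 2 * Real.exp (-(x + a)) := by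
  rw [sechShift, div_le_iff₀ (Real.cosh_pos _), Real.cosh_eq]
  have h : Real.exp (-(x + a)) * Real.exp (x + a) = 1 := by rw [← Real.exp_add]; simp
  nlinarith [Real.exp_pos (-(x + a))]

theorem sechShift_le_exp {a : ℝ} (h : -(1 / 10) ≤ Real.tanh a) (x : ℝ) :
    sechShift a x ≤ 4 * Real.exp (-x) := by
  have h1 := sechShift_le a x
  rw [show -(x + a) = -x + -a by ring, Real.exp_add] at h1
  nlinarith [exp_neg_le_two_of_le_tanh h, Real.exp_pos (-x)]

theorem cosh_le_exp {y : ℝ} (hy : 0 ≤ y) : Real.cosh y ≤ Real.exp y := by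
  rw [Real.cosh_eq]
  linarith [Real.exp_le_exp.2 (show -y ≤ y by linarith)]

/-- The fundamental theorem of calculus on a half-line for locally absolutely continuous
functions. -/
theorem integral_Ioi_eq_of_absolutelyContinuous {F F' : ℝ → ℝ} {l : ℝ}
    (hF : ∀ R, AbsolutelyContinuousOnInterval F 0 R) (h : ∀ᵐ x, HasDerivAt F (F' x) x)
    (hi : IntegrableOn F' (Ioi 0)) (hl : Tendsto F atTop (𝓝 l)) :
    ∫ x in Ioi (0 : ℝ), F' x = l - F 0 := by
  refine tendsto_nhds_unique (intervalIntegral_tendsto_integral_Ioi 0 hi tendsto_id) ?_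
  refine (hl.sub_const (F 0)).congr fun R => ?_
  rw [id, integral_eq_sub_of_absolutelyContinuousOnInterval (hF R) h]

theorem memLp_two_of_abs_le_exp {k : ℝ → ℝ} (hk : Continuous k) {c : ℝ}
    (h : ∀ x, 0 ≤ x → |k x| ≤ c * Real.exp (-x / 2)) :
    MemLp k 2 (volume.restrict (Ioi 0)) ∧ ∫ x in Ioi (0 : ℝ), k x ^ 2 ≤ c ^ 2 := by
  have hexp : IntegrableOn (fun x : ℝ => c ^ 2 * Real.exp (-x)) (Ioi 0) :=
    (integrableOn_exp_neg_Ioi 0).const_mul _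
  have hb : ∀ x, 0 ≤ x → k x ^ 2 ≤ c ^ 2 * Real.exp (-x) := fun x hx => by
    have h1 := pow_le_pow_left₀ (abs_nonneg _) (h x hx) 2
    rwa [sq_abs, mul_pow, ← Real.exp_nat_mul,
      show ((2 : ℕ) : ℝ) * (-x / 2) = -x by push_cast; ring] at h1
  have hi : IntegrableOn (fun x => k x ^ 2) (Ioi 0) := by
    refine Integrable.mono' hexp (hk.pow 2).aestronglyMeasurable ?_
    filter_upwards [ae_restrict_mem measurableSet_Ioi] with x hx
    rw [Real.norm_of_nonneg (sq_nonneg _)]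
    exact hb x (le_of_lt hx)
  refine ⟨(memLp_two_iff_integrable_sq hk.aestronglyMeasurable).2 hi, ?_⟩
  calc ∫ x in Ioi (0 : ℝ), k x ^ 2 ≤ ∫ x in Ioi (0 : ℝ), c ^ 2 * Real.exp (-x) :=
        setIntegral_mono_on hi hexp measurableSet_Ioi fun x hx => hb x (le_of_lt hx)
    _ = c ^ 2 := by
        rw [integral_const_mul, integral_exp_neg_Ioi]
        simp

/-! ### The derivative of the ground state in λ and its tail integral -/

/-- `∂_λ v` at `λ = 1` on the half-line, where `v = sech (x + a)` and `κ = q / (1 - q²)`. -/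
noncomputable def lamDeriv (a κ x : ℝ) : ℝ :=
  sechShift a x * (1 - tanhShift a x * (x - κ))

/-- `v⁻¹ ∫_x^∞ v ∂_λ v`. -/
noncomputable def lamTail (a κ x : ℝ) : ℝ :=
  (Real.exp (-(x + a)) - (x - κ) * sechShift a x) / 2

theorem continuous_lamDeriv (a κ : ℝ) : Continuous (lamDeriv a κ) :=
  (continuous_sechShift a).mul
    (continuous_const.sub ((continuous_tanhShift a).mul (continuous_id.sub continuous_const)))

theorem continuous_lamTail (a κ : ℝ) : Continuous (lamTail a κ) := by
  have := continuous_sechShift a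
  unfold lamTail
  fun_prop

theorem sechShift_mul_exp_neg (a x : ℝ) :
    sechShift a x * Real.exp (-(x + a)) = 1 - tanhShift a x := by
  have h := (Real.cosh_pos (x + a)).ne'
  rw [sechShift, tanhShift, Real.tanh_eq_sinh_div_cosh, ← Real.cosh_sub_sinh]
  field_simp

/-- With `k = lamTail` and `h = f' + T f` this yields `(f k)' = h k - f ∂_λ v`, so that
orthogonality to `∂_λ v` expresses `f(0)` through `h` alone. -/
theorem hasDerivAt_lamTail (a κ x : ℝ) :
    HasDerivAt (lamTail a κ) (-lamDeriv a κ x + tanhShift a x * lamTail a κ x) x := by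
  have h1 := (((hasDerivAt_id x).add_const a).neg.exp.sub
    (((hasDerivAt_id x).sub_const κ).mul (hasDerivAt_sechShift a x))).div_const 2
  have hs := sechShift_mul_exp_neg a x
  have hs2 := sechShift_sq a x
  have hp := (sechShift_pos a x).ne'
  refine h1.congr_deriv ?_
  simp only [lamDeriv, lamTail, id, Pi.neg_apply]
  have he : Real.exp (-(x + a)) = (1 - tanhShift a x) / sechShift a x := by
    rw [eq_div_iff hp, ← hs]
    ring
  rw [he]
  field_simp
  linear_combination hs2

/-- Absorbs the linear growth in `∂_λ v` at the cost of half the exponential decay. -/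
theorem two_add_le_exp {x : ℝ} : 2 + x ≤ 2 * Real.exp (x / 2) := by
  linarith [Real.add_one_le_exp (x / 2)]

theorem exp_neg_mul_exp_half (x : ℝ) :
    Real.exp (-x) * Real.exp (x / 2) = Real.exp (-x / 2) := by
  rw [← Real.exp_add]
  congr 1
  ring

theorem abs_lamTail_le {a κ x : ℝ} (ha : -(1 / 10) ≤ Real.tanh a) (hκ : |κ| ≤ 1) (hx : 0 ≤ x) :
    |lamTail a κ x| ≤ 4 * Real.exp (-x / 2) := by
  have h1 := sechShift_le_exp ha x
  have h2 : Real.exp (-(x + a)) ≤ 2 * Real.exp (-x) := by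
    rw [show -(x + a) = -a + -x by ring, Real.exp_add]
    exact mul_le_mul_of_nonneg_right (exp_neg_le_two_of_le_tanh ha) (Real.exp_pos _).le
  have h3 := sechShift_pos a x
  have h4 := Real.exp_pos (-x)
  have h5 := Real.exp_pos (-(x + a))
  have h6 : |x - κ| ≤ x + 1 := by
    rw [abs_le] at hκ ⊢
    constructor <;> linarith
  have h7 : |(x - κ) * sechShift a x| ≤ (x + 1) * (4 * Real.exp (-x)) := by
    rw [abs_mul, abs_of_pos h3]
    exact mul_le_mul h6 h1 h3.le (by linarith)
  have h8 := mul_le_mul_of_nonneg_left (two_add_le_exp (x := x)) h4.le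
  rw [← exp_neg_mul_exp_half, lamTail]
  rw [abs_le] at h7 ⊢
  constructor <;> nlinarith

theorem abs_lamDeriv_le {a κ x : ℝ} (ha : -(1 / 10) ≤ Real.tanh a) (hκ : |κ| ≤ 1) (hx : 0 ≤ x) :
    |lamDeriv a κ x| ≤ 8 * Real.exp (-x / 2) := by
  have h1 := sechShift_le_exp ha x
  have h3 := sechShift_pos a x
  have h4 := Real.exp_pos (-x)
  have h6 : |x - κ| ≤ x + 1 := by
    rw [abs_le] at hκ ⊢
    constructor <;> linarith
  have h7 : |tanhShift a x * (x - κ)| ≤ 1 * (x + 1) := by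
    rw [abs_mul]
    exact mul_le_mul (abs_le.2 ⟨(neg_one_lt_tanhShift a x).le, (tanhShift_lt_one a x).le⟩) h6
      (abs_nonneg _) zero_le_one
  have h8 := mul_le_mul_of_nonneg_left (two_add_le_exp (x := x)) h4.le
  have h9 : |1 - tanhShift a x * (x - κ)| ≤ 2 + x := by
    rw [abs_le] at h7 ⊢
    constructor <;> linarith
  rw [← exp_neg_mul_exp_half, lamDeriv, abs_mul, abs_of_pos h3]
  calc _ ≤ (4 * Real.exp (-x)) * (2 + x) := mul_le_mul h1 h9 (abs_nonneg _) (by linarith)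
    _ ≤ _ := by linarith

/-- `v(0) * lamTail a κ 0 = ∫_0^∞ v ∂_λ v = 1/2`, half the λ-derivative of `∫_0^∞ v_λ² = λ - q`, and
`v(0) ≤ 1`. This nondegeneracy is what lets orthogonality to `∂_λ v` exclude `v`. -/
theorem lamTail_zero {a κ : ℝ} (hκ : κ * (1 - Real.tanh a ^ 2) = Real.tanh a) :
    1 / 2 ≤ lamTail a κ 0 := by
  have hs := sechShift_mul_exp_neg a 0
  have hs2 := sechShift_sq a 0
  have hp := sechShift_pos a 0
  have h1 := sechShift_le_one a 0
  rw [tanhShift_zero] at hs hs2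
  have h : sechShift a 0 * lamTail a κ 0 = 1 / 2 := by
    rw [lamTail]
    linear_combination (1 / 2) * hs + (κ / 2) * hs2 + hκ / 2
  by_contra! hc
  nlinarith

/-! ### The form of `L₋` on the half-line -/

variable {f g : ℝ → ℝ} {a : ℝ}

theorem integrableOn_mul_mul {b u w : ℝ → ℝ} (hb : Continuous b) {c : ℝ} (hbc : ∀ x, |b x| ≤ c)
    (hu : MemLp u 2 volume) (hw : MemLp w 2 volume) :
    IntegrableOn (fun x => b x * (u x * w x)) (Ioi 0) :=
  ((integrable_mul_of_memLp_two hu hw).bdd_mul hb.aestronglyMeasurable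
    (Eventually.of_forall hbc)).integrableOn

theorem abs_tanhShift_le (a x : ℝ) : |tanhShift a x| ≤ 1 :=
  abs_le.2 ⟨(neg_one_lt_tanhShift a x).le, (tanhShift_lt_one a x).le⟩

theorem memLp_tanhShift_mul (hf2 : MemLp f 2 volume) :
    MemLp (fun x => tanhShift a x * f x) 2 volume :=
  hf2.of_le_mul (c := 1) ((continuous_tanhShift a).aestronglyMeasurable.mul hf2.1)
    (Eventually.of_forall fun x => by
      rw [norm_mul]
      exact mul_le_mul_of_nonneg_right (abs_tanhShift_le a x) (norm_nonneg _))

theorem tendsto_bdd_mul_zero {b w : ℝ → ℝ} {c : ℝ} (hb : ∀ x, |b x| ≤ c)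
    (hw : Tendsto w atTop (𝓝 0)) : Tendsto (fun x => b x * w x) atTop (𝓝 0) := by
  have h := hw.norm.const_mul c
  rw [norm_zero, mul_zero] at h
  refine squeeze_zero_norm (fun x => ?_) h
  rw [norm_mul]
  exact mul_le_mul_of_nonneg_right (hb x) (norm_nonneg _)

/-- Completion of the square for the form of `L₋` on a half-line. -/
theorem integral_sq_add_tanhShift_mul (hf2 : MemLp f 2 volume) (hg2 : MemLp g 2 volume)
    (hfg : ∀ x, f x = f 0 + ∫ t in (0 : ℝ)..x, g t) :
    ∫ x in Ioi (0 : ℝ), (g x + tanhShift a x * f x) ^ 2 =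
      (∫ x in Ioi (0 : ℝ), (g x ^ 2 + f x ^ 2 - 2 * sechShift a x ^ 2 * f x ^ 2))
        - Real.tanh a * f 0 ^ 2 := by
  have hT2 : ∀ x, |tanhShift a x ^ 2| ≤ 1 := fun x => by
    rw [abs_pow]
    exact pow_le_one₀ (abs_nonneg _) (abs_tanhShift_le a x)
  have hT2c : Continuous fun x => tanhShift a x ^ 2 := (continuous_tanhShift a).pow 2
  have i1 := integrableOn_mul_mul (continuous_tanhShift a) (abs_tanhShift_le a) hf2 hg2
  have i2 := integrableOn_mul_mul hT2c hT2 hf2 hf2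
  have i3 : IntegrableOn (fun x => f x * f x) (Ioi 0) :=
    (integrable_mul_of_memLp_two hf2 hf2).integrableOn
  have i4 : IntegrableOn (fun x => g x * g x) (Ioi 0) :=
    (integrable_mul_of_memLp_two hg2 hg2).integrableOn
  have hac : ∀ R, AbsolutelyContinuousOnInterval f 0 R := fun R =>
    absolutelyContinuousOnInterval_of_eq_integral hg2 hfg
  have hd := ae_hasDerivAt_of_eq_integral hg2 hfg
  have h0 := tendsto_atTop_zero_of_eq_integral hf2 hg2 hfg
  have hi1 : IntegrableOn (fun x => (1 - tanhShift a x ^ 2) * (f x * f x)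
      + 2 * (tanhShift a x * (f x * g x))) (Ioi 0) := by
    refine ((i3.sub i2).add (i1.const_mul 2)).congr (Eventually.of_forall fun x => ?_)
    simp only [Pi.add_apply, Pi.sub_apply]
    ring
  -- The cross term `2 T f g` is `(T f²)' - T' f²`; as `T' = sech²`, it supplies the potential and
  -- the boundary term.
  have h1 := integral_Ioi_eq_of_absolutelyContinuous (F := fun x => tanhShift a x * (f x * f x))
    (F' := fun x => (1 - tanhShift a x ^ 2) * (f x * f x) + 2 * (tanhShift a x * (f x * g x)))
    (fun R => (absolutelyContinuousOnInterval_tanhShift a 0 R).fun_mul ((hac R).fun_mul (hac R)))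
    (by
      filter_upwards [hd] with x hx
      exact ((hasDerivAt_tanhShift a x).fun_mul (hx.fun_mul hx)).congr_deriv (by ring))
    hi1
    (tendsto_bdd_mul_zero (abs_tanhShift_le a) (by simpa using h0.mul h0))
  have hi2 : IntegrableOn (fun x => g x ^ 2 + f x ^ 2 - 2 * sechShift a x ^ 2 * f x ^ 2)
      (Ioi 0) := by
    refine ((i4.add i3).sub ((i3.sub i2).const_mul 2)).congr (Eventually.of_forall fun x => ?_)
    simp only [Pi.add_apply, Pi.sub_apply, sechShift_sq]
    ring
  have h2 : ∀ x, (g x + tanhShift a x * f x) ^ 2 =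
      (g x ^ 2 + f x ^ 2 - 2 * sechShift a x ^ 2 * f x ^ 2) +
      ((1 - tanhShift a x ^ 2) * (f x * f x) + 2 * (tanhShift a x * (f x * g x))) := fun x => by
    rw [sechShift_sq]
    ring
  simp_rw [h2]
  rw [integral_add hi2 hi1, h1, tanhShift_zero]
  ring

/-- Coercivity of the form of `L₋` on a half-line. -/
theorem halfLine_minus_coercive {κ : ℝ} (ha : |Real.tanh a| ≤ 1 / 10)
    (hκ : κ * (1 - Real.tanh a ^ 2) = Real.tanh a)
    (hf2 : MemLp f 2 volume) (hg2 : MemLp g 2 volume)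
    (hfg : ∀ x, f x = f 0 + ∫ t in (0 : ℝ)..x, g t)
    (horth : ∫ x in Ioi (0 : ℝ), f x * lamDeriv a κ x = 0) :
    (∫ x in Ioi (0 : ℝ), f x ^ 2) + ∫ x in Ioi (0 : ℝ), g x ^ 2 ≤
      3000 * ((∫ x in Ioi (0 : ℝ), (g x ^ 2 + f x ^ 2 - 2 * sechShift a x ^ 2 * f x ^ 2))
        - Real.tanh a * f 0 ^ 2) := by
  obtain ⟨ha1, ha2⟩ := abs_le.1 ha
  have hκ1 : |κ| ≤ 1 := by
    have hp : 99 / 100 ≤ 1 - Real.tanh a ^ 2 := by nlinarith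
    rw [abs_le]
    constructor <;> by_contra! hc <;> nlinarith
  rw [← integral_sq_add_tanhShift_mul hf2 hg2 hfg]
  set h : ℝ → ℝ := fun x => g x + tanhShift a x * f x with hh
  have hh2 : MemLp h 2 volume := hg2.add (memLp_tanhShift_mul hf2)
  have hac : ∀ R, AbsolutelyContinuousOnInterval f 0 R := fun R =>
    absolutelyContinuousOnInterval_of_eq_integral hg2 hfg
  have hd := ae_hasDerivAt_of_eq_integral hg2 hfg
  have h0 := tendsto_atTop_zero_of_eq_integral hf2 hg2 hfg
  obtain ⟨hk2, hkI⟩ := memLp_two_of_abs_le_exp (continuous_lamTail a κ)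
    fun x hx => abs_lamTail_le ha1 hκ1 hx
  obtain ⟨hl2, -⟩ := memLp_two_of_abs_le_exp (continuous_lamDeriv a κ)
    fun x hx => abs_lamDeriv_le ha1 hκ1 hx
  have ihk : IntegrableOn (fun x => h x * lamTail a κ x) (Ioi 0) :=
    integrable_mul_of_memLp_two (hh2.restrict _) hk2
  have ifl : IntegrableOn (fun x => f x * lamDeriv a κ x) (Ioi 0) :=
    integrable_mul_of_memLp_two (hf2.restrict _) hl2
  have ihh : IntegrableOn (fun x => h x ^ 2) (Ioi 0) := hh2.integrable_sq.integrableOn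
  have iff : IntegrableOn (fun x => f x ^ 2) (Ioi 0) := hf2.integrable_sq.integrableOn
  have igg : IntegrableOn (fun x => g x ^ 2) (Ioi 0) := hg2.integrable_sq.integrableOn
  have ikk : IntegrableOn (fun x => lamTail a κ x ^ 2) (Ioi 0) := hk2.integrable_sq
  have hkt : Tendsto (fun x => f x * lamTail a κ x) atTop (𝓝 0) := by
    have h1 := h0.norm.mul_const 4
    rw [norm_zero, zero_mul] at h1
    refine squeeze_zero_norm' ?_ h1
    filter_upwards [eventually_ge_atTop 0] with x hx
    rw [norm_mul]
    refine mul_le_mul_of_nonneg_left ((abs_lamTail_le ha1 hκ1 hx).trans ?_) (norm_nonneg _)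
    have : Real.exp (-x / 2) ≤ 1 := Real.exp_le_one_iff.2 (by linarith)
    linarith
  -- Becomes `∫ h k = -f(0) k(0)` once orthogonality is used.
  have h1 := integral_Ioi_eq_of_absolutelyContinuous (F := fun x => f x * lamTail a κ x)
    (F' := fun x => h x * lamTail a κ x - f x * lamDeriv a κ x)
    (fun R => (hac R).fun_mul (absolutelyContinuousOnInterval_of_hasDerivAt
      (hasDerivAt_lamTail a κ) ((continuous_lamDeriv a κ).neg.add
        ((continuous_tanhShift a).mul (continuous_lamTail a κ)))))
    (by
      filter_upwards [hd] with x hx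
      exact (hx.fun_mul (hasDerivAt_lamTail a κ x)).congr_deriv (by simp only [hh]; ring))
    (ihk.sub ifl) hkt
  rw [integral_sub ihk ifl, horth, sub_zero, zero_sub] at h1
  set H := ∫ x in Ioi (0 : ℝ), h x ^ 2 with hH
  have hH0 : 0 ≤ H := setIntegral_nonneg measurableSet_Ioi fun x _ => sq_nonneg _
  have hf0 : f 0 ^ 2 ≤ 64 * H := by
    -- Young's inequality with weights chosen for `∫ k² ≤ 16`: the `k` term costs `f(0)²/4`, half of
    -- the lower bound `f(0)²/2` for `f(0)² k(0)`.
    have e1 : ∫ x in Ioi (0 : ℝ), -(f 0) * (h x * lamTail a κ x) ≤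
        ∫ x in Ioi (0 : ℝ), (16 * h x ^ 2 + f 0 ^ 2 / 64 * lamTail a κ x ^ 2) := by
      refine setIntegral_mono (ihk.const_mul _) ((ihh.const_mul _).add (ikk.const_mul _))
        fun x => ?_
      simp only
      nlinarith [sq_nonneg (4 * h x + f 0 / 8 * lamTail a κ x)]
    rw [integral_const_mul, h1, integral_add (ihh.const_mul _) (ikk.const_mul _),
      integral_const_mul, integral_const_mul, ← hH] at e1
    have e2 := lamTail_zero hκ
    nlinarith [sq_nonneg (f 0)]
  have hmb : ∀ x, |2 - tanhShift a x| ≤ 3 := fun x => by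
    rw [abs_le]
    constructor <;> linarith [neg_one_lt_tanhShift a x, tanhShift_lt_one a x]
  have ibd := integrableOn_mul_mul (b := fun x =>
    -(1 - tanhShift a x ^ 2) - 2 * (2 - tanhShift a x) * tanhShift a x) (c := 10)
    (by have := continuous_tanhShift a; fun_prop) (fun x => by
      have := neg_one_lt_tanhShift a x
      have := tanhShift_lt_one a x
      rw [abs_le]
      constructor <;> nlinarith) hf2 hf2
  have ifh := integrableOn_mul_mul (b := fun x => 2 * (2 - tanhShift a x)) (c := 6)
    (by have := continuous_tanhShift a; fun_prop) (fun x => by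
      rw [abs_mul]
      norm_num
      linarith [hmb x]) hf2 hh2
  -- The plain weight `f²` dissipates only `2 T f²`, useless where `T ≤ 0`. The weight `2 - T`
  -- dissipates `(1 + 4T - 3T²) f²`, and this coefficient is at least `1/2` on `[-1/10, 1]`.
  have h2 := integral_Ioi_eq_of_absolutelyContinuous
    (F := fun x => (2 + -tanhShift a x) * (f x * f x))
    (F' := fun x => (-(1 - tanhShift a x ^ 2) - 2 * (2 - tanhShift a x) * tanhShift a x)
      * (f x * f x) + 2 * (2 - tanhShift a x) * (f x * h x))
    (fun R => ((absolutelyContinuousOnInterval_const 2 0 R).add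
      (absolutelyContinuousOnInterval_tanhShift a 0 R).neg).fun_mul ((hac R).fun_mul (hac R)))
    (by
      filter_upwards [hd] with x hx
      exact (((hasDerivAt_tanhShift a x).fun_neg.const_add 2).fun_mul
        (hx.fun_mul hx)).congr_deriv (by simp only [hh]; ring))
    (ibd.add ifh)
    (tendsto_bdd_mul_zero (fun x => by rw [← sub_eq_add_neg]; exact hmb x)
      (by simpa using h0.mul h0))
  have h3 : ∫ x in Ioi (0 : ℝ), ((-(1 - tanhShift a x ^ 2)
      - 2 * (2 - tanhShift a x) * tanhShift a x)
      * (f x * f x) + 2 * (2 - tanhShift a x) * (f x * h x)) ≤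
      ∫ x in Ioi (0 : ℝ), (-(1 / 4) * f x ^ 2 + 18 * h x ^ 2) := by
    refine setIntegral_mono_on (ibd.add ifh) ((iff.const_mul _).add (ihh.const_mul _))
      measurableSet_Ioi fun x hx => ?_
    have t1 : -(1 / 10) ≤ tanhShift a x := ha1.trans (tanh_le_tanhShift (le_of_lt hx))
    have t2 := tanhShift_lt_one a x
    set T := tanhShift a x
    have e1 : 1 / 2 ≤ (1 - T ^ 2) + 2 * (2 - T) * T := by nlinarith
    have e2 := mul_le_mul_of_nonneg_right e1 (sq_nonneg (f x))
    have e3 : (2 - T) ^ 2 ≤ 9 / 2 := by nlinarith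
    have e4 := mul_le_mul_of_nonneg_right e3 (sq_nonneg (h x))
    nlinarith [sq_nonneg (f x / 2 - 2 * (2 - T) * h x)]
  rw [h2, integral_add (iff.const_mul _) (ihh.const_mul _), integral_const_mul,
    integral_const_mul, ← hH, tanhShift_zero] at h3
  have h4 : ∫ x in Ioi (0 : ℝ), g x ^ 2 ≤ ∫ x in Ioi (0 : ℝ), (2 * h x ^ 2 + 2 * f x ^ 2) := by
    refine setIntegral_mono igg ((ihh.const_mul _).add (iff.const_mul _)) fun x => ?_
    have e1 : tanhShift a x ^ 2 ≤ 1 := by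
      have := sq_nonneg (sechShift a x)
      rw [sechShift_sq] at this
      linarith
    have e2 := mul_le_mul_of_nonneg_right e1 (sq_nonneg (f x))
    simp only [hh]
    nlinarith [sq_nonneg (g x + 2 * (tanhShift a x * f x))]
  rw [integral_add (ihh.const_mul _) (iff.const_mul _), integral_const_mul,
    integral_const_mul, ← hH] at h4
  nlinarith [sq_nonneg (f 0)]

/-! ### The form of `L₊` on the half-line -/

/-- `-v⁻¹ ∫_0^x f v`. -/
noncomputable def headRatio (f : ℝ → ℝ) (a x : ℝ) : ℝ :=
  -(∫ t in (0 : ℝ)..x, f t * sechShift a t) / sechShift a x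

theorem headRatio_zero : headRatio f a 0 = 0 := by simp [headRatio]

theorem hasDerivAt_headRatio (hf : Continuous f) (x : ℝ) :
    HasDerivAt (headRatio f a) (tanhShift a x * headRatio f a x - f x) x := by
  have hc : Continuous fun t => f t * sechShift a t := hf.mul (continuous_sechShift a)
  have h1 : HasDerivAt (fun x => ∫ t in (0 : ℝ)..x, f t * sechShift a t)
      (f x * sechShift a x) x :=
    intervalIntegral.integral_hasDerivAt_right (hc.intervalIntegrable _ _)
      hc.stronglyMeasurable.stronglyMeasurableAtFilter hc.continuousAt
  have hp := (sechShift_pos a x).ne'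
  refine (h1.fun_neg.fun_div (hasDerivAt_sechShift a x) hp).congr_deriv ?_
  rw [headRatio]
  field_simp
  ring

theorem continuous_headRatio (hf : Continuous f) : Continuous (headRatio f a) :=
  continuous_iff_continuousAt.2 fun x => (hasDerivAt_headRatio hf x).continuousAt

theorem absolutelyContinuousOnInterval_headRatio (hf : Continuous f) (b c : ℝ) :
    AbsolutelyContinuousOnInterval (headRatio f a) b c :=
  absolutelyContinuousOnInterval_of_hasDerivAt (hasDerivAt_headRatio hf)
    (((continuous_tanhShift a).mul (continuous_headRatio hf)).sub hf)

theorem integrableOn_mul_sechShift (ha : -(1 / 10) ≤ Real.tanh a) (hf2 : MemLp f 2 volume) :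
    IntegrableOn (fun x => f x * sechShift a x) (Ioi 0) := by
  refine integrable_mul_of_memLp_two (hf2.restrict _)
    (memLp_two_of_abs_le_exp (continuous_sechShift a) (c := 4) fun x hx => ?_).1
  rw [abs_of_pos (sechShift_pos a x)]
  refine (sechShift_le_exp ha x).trans ?_
  gcongr
  linarith

/-- Orthogonality turns `-∫_0^x f v` into the tail `∫_x^∞ f v`, which is `o(e^{-x})` because `f →
0`; this beats the growth `e^x` of `1 / v`. -/
theorem tendsto_headRatio (ha : -(1 / 10) ≤ Real.tanh a)
    (hf2 : MemLp f 2 volume) (h0 : Tendsto f atTop (𝓝 0))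
    (horth : ∫ x in Ioi (0 : ℝ), f x * sechShift a x = 0) :
    Tendsto (headRatio f a) atTop (𝓝 0) := by
  have hi := integrableOn_mul_sechShift ha hf2
  rw [Metric.tendsto_atTop]
  intro ε hε
  obtain ⟨N, hN⟩ := Metric.tendsto_atTop.1 h0 (ε / 4) (by positivity)
  refine ⟨max N (max 0 (-a)), fun x hx => ?_⟩
  have hxN : N ≤ x := (le_max_left _ _).trans hx
  have hx0 : 0 ≤ x := (le_max_left _ _).trans ((le_max_right _ _).trans hx)
  have hxa : -a ≤ x := (le_max_right _ _).trans ((le_max_right _ _).trans hx)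
  have hsplit : -(∫ t in (0 : ℝ)..x, f t * sechShift a t) =
      ∫ t in Ioi x, f t * sechShift a t := by
    have := intervalIntegral.integral_Ioi_sub_Ioi hi hx0
    rw [horth] at this
    linarith
  have hexp : IntegrableOn (fun t : ℝ => ε / 4 * (2 * (Real.exp (-a) * Real.exp (-t)))) (Ioi x) :=
    (((integrableOn_exp_neg_Ioi x).const_mul _).const_mul _).const_mul _
  have hb : ‖∫ t in Ioi x, f t * sechShift a t‖ ≤
      ∫ t in Ioi x, ε / 4 * (2 * (Real.exp (-a) * Real.exp (-t))) := by
    refine norm_integral_le_of_norm_le hexp ?_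
    filter_upwards [ae_restrict_mem measurableSet_Ioi] with t ht
    have h1 := hN t (hxN.trans (le_of_lt ht))
    rw [dist_zero_right] at h1
    have h2 := sechShift_le a t
    rw [show -(t + a) = -a + -t by ring, Real.exp_add] at h2
    rw [norm_mul, Real.norm_of_nonneg (sechShift_pos a t).le]
    exact mul_le_mul h1.le h2 (sechShift_pos a t).le (by positivity)
  rw [integral_const_mul, integral_const_mul, integral_const_mul, integral_exp_neg_Ioi] at hb
  rw [dist_zero_right, headRatio, hsplit, norm_div, Real.norm_of_nonneg (sechShift_pos a x).le,
    sechShift, div_div_eq_mul_div, div_one]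
  have hc := cosh_le_exp (show 0 ≤ x + a by linarith)
  have he : Real.exp (-a) * Real.exp (-x) * Real.exp (x + a) = 1 := by
    rw [← Real.exp_add, ← Real.exp_add, ← Real.exp_zero]
    congr 1
    ring
  calc _ ≤ (ε / 4 * (2 * (Real.exp (-a) * Real.exp (-x)))) * Real.exp (x + a) :=
        mul_le_mul hb hc (Real.cosh_pos _).le (by positivity)
    _ = ε / 2 * (Real.exp (-a) * Real.exp (-x) * Real.exp (x + a)) := by ring
    _ < ε := by rw [he]; linarith

/-- Dissipation inequality for the quadratic Lyapunov function
`f² - (1 + 2T) f z + (3/2 + T) z²`. -/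
theorem lyapunov_deriv_le {T f z h : ℝ} (h1 : -(1 / 10) ≤ T) (h2 : T ≤ 1) :
    2 * f * (h - (1 + 2 * T) * f + 2 * (1 + T) * z) - 2 * (1 - T ^ 2) * (f * z)
      - (1 + 2 * T) * ((h - (1 + 2 * T) * f + 2 * (1 + T) * z) * z + f * (T * z - f))
      + (1 - T ^ 2) * (z * z) + (3 / 2 + T) * (2 * z * (T * z - f))
      ≤ -(1 / 100) * f ^ 2 + 213 * h ^ 2 := by
  -- At `h = 0` the left side is `-2 (A f² - B f z + C z²)` up to the `1/100` held back in `A` and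
  -- `C`, which pays for the cross terms with `h`. Positivity is then a discriminant condition on
  -- `[-1/10, 1]`.
  set A := 1 / 2 + T - 1 / 100 with hA
  set B := 5 / 2 * T + 2 * T ^ 2 with hB
  set C := 1 / 2 + 3 / 2 * T + 3 / 2 * T ^ 2 - 1 / 100 with hC
  have hA0 : 0 < A := by linarith
  have hdisc : 0 ≤ 4 * A * C - B ^ 2 := by
    have : 4 * A * C - B ^ 2 = (4 * (49 / 100) ^ 2) + 4 * (49 / 100 * (5 / 2)) * T
        + (4 * (49 / 100 * (3 / 2) + 3 / 2) - 25 / 4) * T ^ 2 - 4 * T ^ 3 - 4 * T ^ 4 := by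
      rw [hA, hB, hC]; ring
    rw [this]
    have e1 : 0 ≤ (1 - T) * (T + 1 / 10) := by nlinarith
    have e2 : T ^ 2 ≤ 1 := by nlinarith
    have e3 : T ^ 2 ≤ 9 / 10 * T + 1 / 10 := by nlinarith
    have e4 : T ^ 3 ≤ T ^ 2 := by nlinarith [sq_nonneg T]
    have e5 : T ^ 4 ≤ T ^ 2 := by nlinarith [sq_nonneg T]
    nlinarith
  have hN : 0 ≤ A * f ^ 2 - B * (f * z) + C * z ^ 2 := by
    have e1 : 0 ≤ 4 * A * (A * f ^ 2 - B * (f * z) + C * z ^ 2) := by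
      have : 4 * A * (A * f ^ 2 - B * (f * z) + C * z ^ 2) =
        (2 * A * f - B * z) ^ 2 + (4 * A * C - B ^ 2) * z ^ 2 := by ring
      rw [this]
      positivity
    exact nonneg_of_mul_nonneg_right e1 (by positivity)
  have e1 : 2 * f * h ≤ 1 / 100 * f ^ 2 + 100 * h ^ 2 := by
    nlinarith [sq_nonneg (f / 10 - 10 * h)]
  have e2 : -((1 + 2 * T) * (z * h)) ≤ 1 / 50 * z ^ 2 + 113 * h ^ 2 := by
    have e3 : (1 + 2 * T) ^ 2 ≤ 9 := by nlinarith
    have e4 := mul_le_mul_of_nonneg_right e3 (sq_nonneg h)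
    nlinarith [sq_nonneg (z + 25 * (1 + 2 * T) * h)]
  have : 2 * f * (h - (1 + 2 * T) * f + 2 * (1 + T) * z) - 2 * (1 - T ^ 2) * (f * z)
      - (1 + 2 * T) * ((h - (1 + 2 * T) * f + 2 * (1 + T) * z) * z + f * (T * z - f))
      + (1 - T ^ 2) * (z * z) + (3 / 2 + T) * (2 * z * (T * z - f)) =
      -2 * (A * f ^ 2 - B * (f * z) + C * z ^ 2) - 1 / 50 * (f ^ 2 + z ^ 2) + 2 * f * h
        - (1 + 2 * T) * (z * h) := by
    rw [hA, hB, hC]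
    ring
  rw [this]
  linarith

/-- Coercivity of the form of `L₊` on a half-line. -/
theorem halfLine_plus_coercive (ha : |Real.tanh a| ≤ 1 / 10) (hf : Continuous f)
    (hf2 : MemLp f 2 volume) (hg2 : MemLp g 2 volume)
    (hfg : ∀ x, f x = f 0 + ∫ t in (0 : ℝ)..x, g t)
    (horth : ∫ x in Ioi (0 : ℝ), f x * sechShift a x = 0) :
    (∫ x in Ioi (0 : ℝ), f x ^ 2) + ∫ x in Ioi (0 : ℝ), g x ^ 2 ≤
      200000 * ((∫ x in Ioi (0 : ℝ), (g x ^ 2 + f x ^ 2 - 6 * sechShift a x ^ 2 * f x ^ 2))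
        - Real.tanh a * f 0 ^ 2) := by
  obtain ⟨ha1, ha2⟩ := abs_le.1 ha
  have hac : ∀ R, AbsolutelyContinuousOnInterval f 0 R := fun R =>
    absolutelyContinuousOnInterval_of_eq_integral hg2 hfg
  have hd := ae_hasDerivAt_of_eq_integral hg2 hfg
  have h0 := tendsto_atTop_zero_of_eq_integral hf2 hg2 hfg
  set z := headRatio f a with hz
  set T := tanhShift a with hT
  have hzc : Continuous z := continuous_headRatio hf
  have hTc : Continuous T := continuous_tanhShift a
  have hzd : ∀ x, HasDerivAt z (T x * z x - f x) x := hasDerivAt_headRatio hf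
  have hTd : ∀ x, HasDerivAt T (1 - T x ^ 2) x := hasDerivAt_tanhShift a
  have hzac : ∀ R, AbsolutelyContinuousOnInterval z 0 R :=
    absolutelyContinuousOnInterval_headRatio hf 0
  have hTac : ∀ R, AbsolutelyContinuousOnInterval T 0 R :=
    absolutelyContinuousOnInterval_tanhShift a 0
  have hz0 : Tendsto z atTop (𝓝 0) := tendsto_headRatio ha1 hf2 h0 horth
  have iff : Integrable (fun x => f x ^ 2) := hf2.integrable_sq
  have igg : Integrable (fun x => g x ^ 2) := hg2.integrable_sq
  have isf : Integrable (fun x => sechShift a x ^ 2 * f x ^ 2) := by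
    refine iff.bdd_mul (c := 1) ((continuous_sechShift a).pow 2).aestronglyMeasurable
      (Eventually.of_forall fun x => ?_)
    rw [norm_pow, Real.norm_of_nonneg (sechShift_pos a x).le]
    exact pow_le_one₀ (sechShift_pos a x).le (sechShift_le_one a x)
  set e : ℝ → ℝ := fun x => g x ^ 2 + f x ^ 2 - 6 * sechShift a x ^ 2 * f x ^ 2 with he
  have ie : Integrable e := by
    refine ((igg.add iff).sub (isf.const_mul 6)).congr (Eventually.of_forall fun x => ?_)
    simp only [he, Pi.add_apply, Pi.sub_apply]
    ring
  set h : ℝ → ℝ := fun x => g x + (1 + 2 * T x) * f x - 2 * (1 + T x) * z x with hh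
  -- Square integrability of `z`, hence of `h`, on the whole half-line is not known here, so
  -- identities are taken on `[0, R]` and passed to the limit.
  have ihh : ∀ R, IntervalIntegrable (fun x => h x ^ 2) volume 0 R := fun R => by
    have i1 : IntervalIntegrable (fun x => g x ^ 2) volume 0 R := igg.intervalIntegrable
    have hw : Continuous fun x => (1 + 2 * T x) * f x - 2 * (1 + T x) * z x := by fun_prop
    have i2 := (intervalIntegrable_of_memLp_two hg2 0 R).mul_continuousOn
      (g := fun x => (1 + 2 * T x) * f x - 2 * (1 + T x) * z x) hw.continuousOn
    have i3 := (hw.pow 2).intervalIntegrable 0 R (μ := volume)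
    refine (((i1.add (i2.const_mul 2)).add i3)).congr ?_
    intro x _
    simp only [hh, Pi.pow_apply]
    ring
  -- The coefficients solve the Riccati equation of the system `(f, z)`: they make `V' + e` the
  -- perfect square `h²`.
  set V : ℝ → ℝ := fun x => (1 + 2 * T x) * (f x * f x) + (-4) * ((1 + T x) * (f x * z x))
    + 4 * ((T x * (1 + T x)) * (z x * z x)) with hV
  set W : ℝ → ℝ := fun x => f x * f x + (-1) * ((1 + 2 * T x) * (f x * z x))
    + (3 / 2 + T x) * (z x * z x) with hW
  have hc : ∀ c R, AbsolutelyContinuousOnInterval (fun _ => c) 0 R := fun c R =>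
    absolutelyContinuousOnInterval_const c 0 R
  have a1 : ∀ R, AbsolutelyContinuousOnInterval (fun x => 1 + T x) 0 R := fun R =>
    (hc 1 R).add (hTac R)
  have a2 : ∀ R, AbsolutelyContinuousOnInterval (fun x => 1 + 2 * T x) 0 R := fun R =>
    (hc 1 R).add ((hTac R).const_mul 2)
  have hVac : ∀ R, AbsolutelyContinuousOnInterval V 0 R := fun R =>
    (((a2 R).fun_mul ((hac R).fun_mul (hac R))).add
      (((a1 R).fun_mul ((hac R).fun_mul (hzac R))).const_mul (-4))).add
      ((((hTac R).fun_mul (a1 R)).fun_mul ((hzac R).fun_mul (hzac R))).const_mul 4)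
  have hWac : ∀ R, AbsolutelyContinuousOnInterval W 0 R := fun R =>
    (((hac R).fun_mul (hac R)).add
      (((a2 R).fun_mul ((hac R).fun_mul (hzac R))).const_mul (-1))).add
      (((hc (3 / 2) R).add (hTac R)).fun_mul ((hzac R).fun_mul (hzac R)))
  have hVd : ∀ᵐ x, HasDerivAt V (h x ^ 2 - e x) x := by
    filter_upwards [hd] with x hx
    have d1 := (((hTd x).const_mul 2).const_add 1).fun_mul (hx.fun_mul hx)
    have d2 := (((hTd x).const_add 1).fun_mul (hx.fun_mul (hzd x))).const_mul (-4)
    have d3 := (((hTd x).fun_mul ((hTd x).const_add 1)).fun_mul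
      ((hzd x).fun_mul (hzd x))).const_mul 4
    refine ((d1.fun_add d2).fun_add d3).congr_deriv ?_
    simp only [hh, he, sechShift_sq]
    rw [← hT]
    ring
  have hWd : ∀ᵐ x, HasDerivAt W
      (2 * f x * (h x - (1 + 2 * T x) * f x + 2 * (1 + T x) * z x)
      - 2 * (1 - T x ^ 2) * (f x * z x)
      - (1 + 2 * T x) * ((h x - (1 + 2 * T x) * f x + 2 * (1 + T x) * z x) * z x
        + f x * (T x * z x - f x))
      + (1 - T x ^ 2) * (z x * z x) + (3 / 2 + T x) * (2 * z x * (T x * z x - f x))) x := by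
    filter_upwards [hd] with x hx
    have d2 := ((((hTd x).const_mul 2).const_add 1).fun_mul (hx.fun_mul (hzd x))).const_mul (-1)
    have d3 := ((hTd x).const_add (3 / 2)).fun_mul ((hzd x).fun_mul (hzd x))
    refine (((hx.fun_mul hx).fun_add d2).fun_add d3).congr_deriv ?_
    simp only [hh]
    ring
  have hVI : ∀ R, ∫ x in (0 : ℝ)..R, h x ^ 2 = V R - V 0 + ∫ x in (0 : ℝ)..R, e x := fun R => by
    rw [← integral_eq_sub_of_absolutelyContinuousOnInterval (hVac R) hVd,
      intervalIntegral.integral_sub (ihh R) ie.intervalIntegrable]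
    ring
  have hV0 : V 0 = (1 + 2 * Real.tanh a) * f 0 ^ 2 := by
    simp only [hV, hz, hT, headRatio_zero, tanhShift_zero]
    ring
  have hW0 : W 0 = f 0 ^ 2 := by
    simp only [hW, hz, headRatio_zero]
    ring
  have hT1 : ∀ x, |T x| ≤ 1 := abs_tanhShift_le a
  have hVl : Tendsto V atTop (𝓝 0) := by
    have l1 := tendsto_bdd_mul_zero (b := fun x => 1 + 2 * T x) (c := 3) (fun x => by
      have := abs_le.1 (hT1 x)
      rw [abs_le]; constructor <;> linarith) (w := fun x => f x * f x) (by simpa using h0.mul h0)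
    have l2 := tendsto_bdd_mul_zero (b := fun x => 1 + T x) (c := 2) (fun x => by
      have := abs_le.1 (hT1 x)
      rw [abs_le]; constructor <;> linarith) (w := fun x => f x * z x) (by simpa using h0.mul hz0)
    have l3 := tendsto_bdd_mul_zero (b := fun x => T x * (1 + T x)) (c := 2) (fun x => by
      have := abs_le.1 (hT1 x)
      rw [abs_le]; constructor <;> nlinarith) (w := fun x => z x * z x)
      (by simpa using hz0.mul hz0)
    have l4 := (l1.add (l2.const_mul (-4))).add (l3.const_mul 4)
    rwa [mul_zero, mul_zero, add_zero, add_zero] at l4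
  -- Nonnegativity lets the endpoint value `W R` be dropped from the dissipation estimate.
  have hWnn : ∀ x, 0 ≤ W x := fun x => by
    have ht := abs_le.1 (hT1 x)
    have e1 : 0 ≤ (5 / 4 - T x ^ 2) * z x ^ 2 := mul_nonneg (by nlinarith) (sq_nonneg _)
    have : W x = (f x - (1 / 2 + T x) * z x) ^ 2 + (5 / 4 - T x ^ 2) * z x ^ 2 := by
      simp only [hW]
      ring
    rw [this]
    positivity
  have hEl := intervalIntegral_tendsto_integral_Ioi 0 ie.integrableOn tendsto_id
  have hFl := intervalIntegral_tendsto_integral_Ioi 0 iff.integrableOn tendsto_id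
  simp only [id] at hEl hFl
  set Q := ∫ x in Ioi (0 : ℝ), e x with hQ
  set F := ∫ x in Ioi (0 : ℝ), f x ^ 2 with hF
  have hl : Tendsto (fun R => V R - V 0 + ∫ x in (0 : ℝ)..R, e x) atTop (𝓝 (0 - V 0 + Q)) :=
    (hVl.sub_const _).add hEl
  -- The quantity is `lim ∫_0^R h²`. As `V 0 = (1 + 2 tanh a) f(0)²`, the form is this limit plus
  -- `(1 + tanh a) f(0)²`, so it controls `f(0)²` directly.
  have hp1 : 0 ≤ 0 - V 0 + Q := by
    refine ge_of_tendsto hl ?_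
    filter_upwards [eventually_ge_atTop 0] with R hR
    rw [← hVI]
    exact intervalIntegral.integral_nonneg hR fun x _ => sq_nonneg _
  have hp2 : 1 / 100 * F ≤ W 0 + 213 * (0 - V 0 + Q) := by
    refine le_of_tendsto_of_tendsto (hFl.const_mul _) ((hl.const_mul 213).const_add (W 0)) ?_
    filter_upwards [eventually_ge_atTop 0] with R hR
    have e1 : W R - W 0 ≤ ∫ x in (0 : ℝ)..R, (-(1 / 100) * f x ^ 2 + 213 * h x ^ 2) := by
      rw [← (hWac R).integral_deriv_eq_sub]
      refine intervalIntegral.integral_mono_ae_restrict hR (hWac R).intervalIntegrable_deriv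
        ((iff.intervalIntegrable.const_mul _).add ((ihh R).const_mul _)) ?_
      filter_upwards [ae_restrict_of_ae hWd, ae_restrict_mem measurableSet_Icc] with x hx hxR
      rw [hx.deriv]
      exact lyapunov_deriv_le (ha1.trans (tanh_le_tanhShift hxR.1)) (tanhShift_lt_one a x).le
    rw [intervalIntegral.integral_add (iff.intervalIntegrable.const_mul _) ((ihh R).const_mul _),
      intervalIntegral.integral_const_mul, intervalIntegral.integral_const_mul, hVI] at e1
    linarith [hWnn R]
  have hG : ∫ x in Ioi (0 : ℝ), g x ^ 2 ≤ Q + 5 * F := by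
    rw [hQ, hF, ← integral_const_mul, ← integral_add ie.integrableOn (iff.const_mul 5).integrableOn]
    refine setIntegral_mono igg.integrableOn (ie.add (iff.const_mul 5)).integrableOn fun x => ?_
    have e1 : sechShift a x ^ 2 ≤ 1 := pow_le_one₀ (sechShift_pos a x).le (sechShift_le_one a x)
    have e2 := mul_le_mul_of_nonneg_right e1 (sq_nonneg (f x))
    simp only [he]
    linarith
  rw [hV0] at hp1 hp2
  rw [hW0] at hp2
  have hf0 := sq_nonneg (f 0)
  nlinarith

/-! ### The ground state and its λ-derivative at `λ = 1` -/

theorem groundState_one (q x : ℝ) : groundState 1 q x = sechShift (Real.artanh q) |x| := by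
  simp [groundState, sechShift]

theorem hasDerivAt_artanh {q : ℝ} (hq : q ∈ Ioo (-1 : ℝ) 1) :
    HasDerivAt Real.artanh (1 / (1 - q ^ 2)) q := by
  have h1 : 0 < 1 - q := by linarith [hq.2]
  have h2 : 0 < 1 + q := by linarith [hq.1]
  have h3 : 1 - q ^ 2 ≠ 0 := by nlinarith
  have hd := (((hasDerivAt_id q).const_add 1).div ((hasDerivAt_id q).const_sub 1)
    h1.ne').log (div_pos h2 h1).ne'
  have he : Real.artanh =ᶠ[𝓝 q] fun x => 1 / 2 * Real.log ((1 + x) / (1 - x)) := by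
    filter_upwards [Ioo_mem_nhds hq.1 hq.2] with x hx
    exact Real.artanh_eq_half_log (Ioo_subset_Icc_self hx)
  refine ((hd.const_mul (1 / 2)).congr_of_eventuallyEq he).congr_deriv ?_
  simp only [id, Pi.div_apply]
  field_simp
  ring

theorem dGroundState_one {q : ℝ} (hq : q ∈ Ioo (-1 : ℝ) 1) (x : ℝ) :
    dGroundState 1 q x = lamDeriv (Real.artanh q) (q / (1 - q ^ 2)) |x| := by
  have hc := (Real.cosh_pos (|x| + Real.artanh q)).ne'
  have h3 : 1 - q ^ 2 ≠ 0 := by nlinarith [hq.1, hq.2]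
  have hq1 : HasDerivAt (fun mu : ℝ => q / mu) (-q) 1 := by
    have := (hasDerivAt_const (1 : ℝ) q).fun_div (hasDerivAt_id (1 : ℝ)) one_ne_zero
    refine this.congr_deriv ?_
    simp
  have ha : HasDerivAt (fun mu : ℝ => Real.artanh (q / mu)) (1 / (1 - q ^ 2) * -q) 1 :=
    HasDerivAt.comp (1 : ℝ) (h₂ := Real.artanh) (by simpa using hasDerivAt_artanh hq) hq1
  have hin := ((hasDerivAt_id (1 : ℝ)).mul_const |x|).fun_add ha
  have hd := (hasDerivAt_id (1 : ℝ)).fun_div hin.cosh (by simpa using hc)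
  have he : dGroundState 1 q x = _ := hd.deriv
  rw [he, lamDeriv, sechShift, tanhShift, Real.tanh_eq_sinh_div_cosh]
  simp only [id, one_mul, div_one]
  field_simp
  ring

/-! ### From the half-line to even functions on the line -/

theorem integrable_of_even {F : ℝ → ℝ} (hF : ∀ x, F (-x) = F x) (hi : IntegrableOn F (Ioi 0)) :
    Integrable F := by
  rw [← integrableOn_univ, ← Iic_union_Ioi (a := (0 : ℝ))]
  refine IntegrableOn.union ?_ hi
  rw [integrableOn_Iic_iff_integrableOn_Iio]
  rw [← (Measure.measurePreserving_neg (volume : Measure ℝ)).integrableOn_comp_preimage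
    (Homeomorph.neg ℝ).measurableEmbedding, neg_preimage, neg_Ioi, neg_zero] at hi
  exact hi.congr_fun (fun x _ => hF x) measurableSet_Iio

theorem memLp_two_comp_abs {k : ℝ → ℝ} (hk : Continuous k)
    (h : MemLp k 2 (volume.restrict (Ioi 0))) : MemLp (fun x => k |x|) 2 volume := by
  have hc : Continuous fun x => k |x| := hk.comp continuous_abs
  rw [memLp_two_iff_integrable_sq hc.aestronglyMeasurable]
  refine integrable_of_even (fun x => by rw [abs_neg]) ?_
  refine IntegrableOn.congr_fun (f := fun x => k x ^ 2) h.integrable_sq (fun x hx => ?_)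
    measurableSet_Ioi
  simp only
  rw [abs_of_pos hx]

/-- Coercivity of a form on a half-line gives coercivity on even functions on the line. -/
theorem even_coercive_of_halfLine {u g : ℝ → ℝ} {k q C a : ℝ}
    (heven : ∀ x, u (-x) = u x) (hu2 : MemLp u 2 volume) (hg2 : MemLp g 2 volume)
    (hug : ∀ x, u x = u 0 + ∫ t in (0 : ℝ)..x, g t)
    (hhalf : ∀ g' : ℝ → ℝ, MemLp g' 2 volume → (∀ x, u x = u 0 + ∫ t in (0 : ℝ)..x, g' t) →
      (∫ x in Ioi (0 : ℝ), u x ^ 2) + ∫ x in Ioi (0 : ℝ), g' x ^ 2 ≤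
      C * ((∫ x in Ioi (0 : ℝ), (g' x ^ 2 + u x ^ 2 - k * sechShift a x ^ 2 * u x ^ 2))
        - q * u 0 ^ 2)) :
    (∫ x, u x ^ 2) + ∫ x, g x ^ 2 ≤ C * ((∫ x, u x ^ 2) + (∫ x, g x ^ 2)
      - k * (∫ x, sechShift a |x| ^ 2 * u x ^ 2) - 2 * q * u 0 ^ 2) := by
  have iuu : Integrable (fun x => u x ^ 2) := hu2.integrable_sq
  have igg : Integrable (fun x => g x ^ 2) := hg2.integrable_sq
  have igg' : Integrable (fun x => g (-x) ^ 2) := igg.comp_neg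
  have isu : Integrable (fun x => sechShift a x ^ 2 * u x ^ 2) := by
    refine iuu.bdd_mul (c := 1) ((continuous_sechShift a).pow 2).aestronglyMeasurable
      (Eventually.of_forall fun x => ?_)
    rw [norm_pow, Real.norm_of_nonneg (sechShift_pos a x).le]
    exact pow_le_one₀ (sechShift_pos a x).le (sechShift_le_one a x)
  -- By evenness `-g(-x)` is another derivative of `u`, so the half-line bound covers the left half
  -- of `g` as well, without showing that `g` is odd.
  have hg2' : MemLp (fun x => -g (-x)) 2 volume :=
    (hg2.comp_measurePreserving (Measure.measurePreserving_neg volume)).neg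
  have hug' : ∀ x, u x = u 0 + ∫ t in (0 : ℝ)..x, -g (-t) := fun x => by
    rw [intervalIntegral.integral_neg, intervalIntegral.integral_comp_neg, ← heven x, hug (-x),
      neg_zero, intervalIntegral.integral_symm]
  have h1 := hhalf g hg2 hug
  have h2 := hhalf _ hg2' hug'
  have habs : ∀ x, u |x| = u x := fun x => by
    rcases abs_choice x with h | h <;> rw [h]
    exact heven x
  have e1 : ∫ x, u x ^ 2 = 2 * ∫ x in Ioi (0 : ℝ), u x ^ 2 := by
    rw [← integral_comp_abs (f := fun x => u x ^ 2)]
    simp only [habs]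
  have e2 : ∫ x, sechShift a |x| ^ 2 * u x ^ 2 =
      2 * ∫ x in Ioi (0 : ℝ), sechShift a x ^ 2 * u x ^ 2 := by
    rw [← integral_comp_abs (f := fun x => sechShift a x ^ 2 * u x ^ 2)]
    simp only [habs]
  have e3 : ∫ x, g x ^ 2 = (∫ x in Ioi (0 : ℝ), g x ^ 2) + ∫ x in Ioi (0 : ℝ), g (-x) ^ 2 := by
    rw [← intervalIntegral.integral_Iic_add_Ioi (b := 0) igg.integrableOn igg.integrableOn,
      integral_comp_neg_Ioi 0 (fun x => g x ^ 2), neg_zero, add_comm]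
  have e4 : ∀ G : ℝ → ℝ, Integrable (fun x => G x ^ 2) →
      ∫ x in Ioi (0 : ℝ), (G x ^ 2 + u x ^ 2 - k * sechShift a x ^ 2 * u x ^ 2) =
      (∫ x in Ioi (0 : ℝ), G x ^ 2) + (∫ x in Ioi (0 : ℝ), u x ^ 2)
        - k * ∫ x in Ioi (0 : ℝ), sechShift a x ^ 2 * u x ^ 2 := fun G hG => by
    have i1 : IntegrableOn (fun x => G x ^ 2 + u x ^ 2) (Ioi 0) := (hG.add iuu).integrableOn
    rw [← integral_const_mul, ← integral_add hG.integrableOn iuu.integrableOn,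
      ← integral_sub i1 (isu.const_mul k).integrableOn]
    simp only [mul_assoc]
  simp only [neg_sq] at h2
  rw [e4 g igg] at h1
  rw [e4 (fun x => g (-x)) igg'] at h2
  rw [e1, e2, e3]
  linarith

/-! ### Splitting into real and imaginary parts -/

theorem IsWeakDeriv.clm_comp {E F : Type*} [NormedAddCommGroup E] [NormedSpace ℝ E]
    [CompleteSpace E] [NormedAddCommGroup F] [NormedSpace ℝ F] [CompleteSpace F] (L : E →L[ℝ] F)
    {f g : ℝ → E} (hf : LocallyIntegrable f) (hg : LocallyIntegrable g)
    (h : IsWeakDeriv f g) : IsWeakDeriv (fun x => L (f x)) fun x => L (g x) := by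
  intro φ hφ hc
  have h1 := congrArg L (h φ hφ hc)
  have hφ' : Continuous (deriv φ) := hφ.continuous_deriv (by simp)
  rw [map_neg, ← L.integral_comp_comm (hf.integrable_smul_left_of_hasCompactSupport hφ' hc.deriv),
    ← L.integral_comp_comm (hg.integrable_smul_left_of_hasCompactSupport hφ.continuous hc)] at h1
  simpa only [map_smul] using h1

theorem MemH1.clm_comp {f : ℝ → ℂ} (hf : MemH1 f) (L : ℂ →L[ℝ] ℝ) :
    MemH1 (fun x => L (f x)) ∧
      weakDeriv (fun x => L (f x)) =ᵐ[volume] fun x => L (weakDeriv f x) := by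
  have hs := hf.weakDeriv_spec
  have hw : IsWeakDeriv (fun x => L (f x)) fun x => L (weakDeriv f x) :=
    hs.2.clm_comp L hf.1.locallyIntegrable (hs.1.locallyIntegrable (by norm_num))
  have hm : MemLp (fun x => L (weakDeriv f x)) 2 volume := L.comp_memLp' hs.1
  have hH : MemH1 (fun x => L (f x)) := ⟨L.continuous.comp hf.1, L.comp_memLp' hf.2.1, _, hm, hw⟩
  exact ⟨hH, hH.weakDeriv_spec.2.ae_eq hw hH.weakDeriv_spec.1 hm⟩

theorem integral_norm_sq_eq {f : ℝ → ℂ} (hf : MemLp f 2 volume) :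
    ∫ x, ‖f x‖ ^ 2 = (∫ x, (f x).re ^ 2) + ∫ x, (f x).im ^ 2 := by
  have h1 : MemLp (fun x => (f x).re) 2 volume := Complex.reCLM.comp_memLp' hf
  have h2 : MemLp (fun x => (f x).im) 2 volume := Complex.imCLM.comp_memLp' hf
  rw [← integral_add h1.integrable_sq h2.integrable_sq]
  refine integral_congr_ae (Eventually.of_forall fun x => ?_)
  simp only [Complex.sq_norm, Complex.normSq_apply]
  ring

theorem h1NormSq_eq {f : ℝ → ℂ} (hf : MemH1 f) :
    h1NormSq f = ((∫ x, (f x).re ^ 2) + ∫ x, weakDeriv (fun x => (f x).re) x ^ 2) +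
      ((∫ x, (f x).im ^ 2) + ∫ x, weakDeriv (fun x => (f x).im) x ^ 2) := by
  have h1 : ∫ x, weakDeriv (fun x => (f x).re) x ^ 2 = ∫ x, (weakDeriv f x).re ^ 2 := by
    refine integral_congr_ae ?_
    filter_upwards [(hf.clm_comp Complex.reCLM).2] with x hx
    exact congrArg (· ^ 2) hx
  have h2 : ∫ x, weakDeriv (fun x => (f x).im) x ^ 2 = ∫ x, (weakDeriv f x).im ^ 2 := by
    refine integral_congr_ae ?_
    filter_upwards [(hf.clm_comp Complex.imCLM).2] with x hx
    exact congrArg (· ^ 2) hx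
  rw [h1, h2, h1NormSq, integral_norm_sq_eq hf.2.1, integral_norm_sq_eq hf.weakDeriv_spec.1]
  ring

theorem scalarPairing_self (k q : ℝ) (u : ℝ → ℝ) :
    scalarPairing k 1 q u u = 1 / 2 * ((∫ x, u x ^ 2) + (∫ x, weakDeriv u x ^ 2)
      - k * (∫ x, sechShift (Real.artanh q) |x| ^ 2 * u x ^ 2) - 2 * q * u 0 ^ 2) := by
  simp only [scalarPairing, groundState_one, ← sq, one_pow, one_mul]

/-! ### Coercivity of the two scalar forms on even functions -/

variable {u : ℝ → ℝ} {q : ℝ}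

theorem integral_Ioi_eq_zero_of_even (heven : ∀ x, u (-x) = u x) {k : ℝ → ℝ}
    (h : ∫ x, u x * k |x| = 0) : ∫ x in Ioi (0 : ℝ), u x * k x = 0 := by
  have habs : ∀ x, u |x| = u x := fun x => by
    rcases abs_choice x with h | h <;> rw [h]
    exact heven x
  have e1 := integral_comp_abs (f := fun x => u x * k x)
  simp only [habs, h] at e1
  linarith

theorem LPlusPairing_coercive (hq : |q| < 1 / 10) (hu : MemH1 u) (heven : ∀ x, u (-x) = u x)
    (horth : ∫ x, u x * groundState 1 q x = 0) :
    (∫ x, u x ^ 2) + ∫ x, weakDeriv u x ^ 2 ≤ 400000 * LPlusPairing 1 q u u := by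
  have hq' := abs_lt.1 hq
  have ht : Real.tanh (Real.artanh q) = q := Real.tanh_artanh ⟨by linarith, by linarith⟩
  obtain ⟨hg2, hw⟩ := hu.weakDeriv_spec
  simp only [groundState_one] at horth
  have h := even_coercive_of_halfLine (k := 6) (q := q) (C := 200000) (a := Real.artanh q)
    heven hu.2.1 hg2 (hw.eq_integral hu.1 hg2) fun g' hg' hug' => by
      have := halfLine_plus_coercive (a := Real.artanh q) (by rw [ht]; exact hq.le) hu.1 hu.2.1
        hg' hug' (integral_Ioi_eq_zero_of_even heven horth)
      rwa [ht] at this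
  rw [LPlusPairing, scalarPairing_self]
  linarith

theorem LMinusPairing_coercive (hq : |q| < 1 / 10) (hu : MemH1 u) (heven : ∀ x, u (-x) = u x)
    (horth : ∫ x, u x * dGroundState 1 q x = 0) :
    (∫ x, u x ^ 2) + ∫ x, weakDeriv u x ^ 2 ≤ 6000 * LMinusPairing 1 q u u := by
  have hq' := abs_lt.1 hq
  have hq1 : q ∈ Ioo (-1 : ℝ) 1 := ⟨by linarith, by linarith⟩
  have ht : Real.tanh (Real.artanh q) = q := Real.tanh_artanh hq1
  have h3 : 1 - q ^ 2 ≠ 0 := by nlinarith [hq1.1, hq1.2]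
  obtain ⟨hg2, hw⟩ := hu.weakDeriv_spec
  simp only [dGroundState_one hq1] at horth
  have h := even_coercive_of_halfLine (k := 2) (q := q) (C := 3000) (a := Real.artanh q)
    heven hu.2.1 hg2 (hw.eq_integral hu.1 hg2) fun g' hg' hug' => by
      have := halfLine_minus_coercive (a := Real.artanh q) (κ := q / (1 - q ^ 2))
        (by rw [ht]; exact hq.le) (by rw [ht]; field_simp) hu.2.1
        hg' hug' (integral_Ioi_eq_zero_of_even heven horth)
      rwa [ht] at this
  rw [LMinusPairing, scalarPairing_self]
  linarith

/-! ### The symplectic orthogonality conditions -/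

theorem memLp_groundState (hq : |q| < 1 / 10) : MemLp (groundState 1 q) 2 volume := by
  have hq' := abs_lt.1 hq
  have ht : Real.tanh (Real.artanh q) = q := Real.tanh_artanh ⟨by linarith, by linarith⟩
  rw [show groundState 1 q = fun x => sechShift (Real.artanh q) |x| from
    funext (groundState_one q)]
  refine memLp_two_comp_abs (continuous_sechShift _)
    (memLp_two_of_abs_le_exp (continuous_sechShift _) (c := 4) fun x hx => ?_).1
  rw [abs_of_pos (sechShift_pos _ x)]
  refine (sechShift_le_exp (by rw [ht]; linarith) x).trans ?_
  gcongr
  linarith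

theorem memLp_dGroundState (hq : |q| < 1 / 10) : MemLp (dGroundState 1 q) 2 volume := by
  have hq' := abs_lt.1 hq
  have hq1 : q ∈ Ioo (-1 : ℝ) 1 := ⟨by linarith, by linarith⟩
  have ht : Real.tanh (Real.artanh q) = q := Real.tanh_artanh hq1
  rw [show dGroundState 1 q = fun x => lamDeriv (Real.artanh q) (q / (1 - q ^ 2)) |x| from
    funext (dGroundState_one hq1)]
  have hp : 99 / 100 ≤ 1 - q ^ 2 := by nlinarith
  refine memLp_two_comp_abs (continuous_lamDeriv _ _)
    (memLp_two_of_abs_le_exp (continuous_lamDeriv _ _) (c := 8) fun x hx =>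
      abs_lamDeriv_le (by rw [ht]; linarith) ?_ hx).1
  rw [abs_div, abs_of_pos (show 0 < 1 - q ^ 2 by linarith), div_le_one (by linarith)]
  linarith

theorem omega_ofReal {f : ℝ → ℂ} (hf : MemLp f 2 volume) {w : ℝ → ℝ} (hw : MemLp w 2 volume) :
    omega f (fun y => (w y : ℂ)) = ∫ x, (f x).im * w x := by
  have hw' : MemLp (fun x => (w x : ℂ)) 2 volume := hw.ofReal
  have hi : Integrable (fun x => f x * (w x : ℂ)) := hf.integrable_mul hw'
  simp only [omega, Complex.conj_ofReal]
  rw [← Complex.imCLM_apply, ← Complex.imCLM.integral_comp_comm hi]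
  simp

theorem omega_I_mul_ofReal {f : ℝ → ℂ} (hf : MemLp f 2 volume) {w : ℝ → ℝ}
    (hw : MemLp w 2 volume) :
    omega f (fun y => Complex.I * (w y : ℂ)) = -∫ x, (f x).re * w x := by
  have hw' : MemLp (fun x => (w x : ℂ)) 2 volume := hw.ofReal
  have hi : Integrable (fun x => f x * (starRingEnd ℂ) (Complex.I * (w x : ℂ))) := by
    refine ((hf.integrable_mul hw').const_mul (-Complex.I)).congr (Eventually.of_forall fun x => ?_)
    simp only [Pi.mul_apply, map_mul, Complex.conj_I, Complex.conj_ofReal]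
    ring
  rw [omega, ← Complex.imCLM_apply, ← Complex.imCLM.integral_comp_comm hi, ← integral_neg]
  simp

/-- `i v` is imaginary and `∂_λ v` is real, so the value at the single point 0 separates the
coefficients: `v(0) > 0` and `∂_λ v(0) = v(0) / (1 - q²) > 0`. -/
theorem omega_eq_zero_of_proj_eq_zero {f : ℝ → ℂ} (hq : q ∈ Ioo (-1 : ℝ) 1)
    (h : proj 1 q f = 0) :
    omega f (fun y => (dGroundState 1 q y : ℂ)) = 0 ∧
      omega f (fun y => Complex.I * (groundState 1 q y : ℂ)) = 0 := by
  have h0 := congrFun h 0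
  simp only [proj, Pi.zero_apply] at h0
  have h1 := congrArg Complex.re h0
  have h2 := congrArg Complex.im h0
  simp at h1 h2
  have hv : groundState 1 q 0 ≠ 0 := by
    rw [groundState_one]
    exact (sechShift_pos _ _).ne'
  have hp : 0 < 1 - q ^ 2 := by nlinarith [hq.1, hq.2]
  have hw : dGroundState 1 q 0 ≠ 0 := by
    rw [dGroundState_one hq, abs_zero, lamDeriv, tanhShift_zero, Real.tanh_artanh hq]
    refine mul_ne_zero (sechShift_pos _ _).ne' ?_
    have : 0 ≤ q * (q / (1 - q ^ 2)) := by
      rw [← mul_div_assoc]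
      exact div_nonneg (mul_self_nonneg q) hp.le
    linarith
  exact ⟨h2.resolve_right hv, h1.resolve_right hw⟩

end DeltaNLS

theorem mainTheorem9 :
    ∃ c₀ : ℝ, 0 < c₀ ∧ ∃ q₀ : ℝ, 0 < q₀ ∧ q₀ < 1 ∧
      ∀ q : ℝ, |q| < q₀ → ∀ f : ℝ → ℂ,
        DeltaNLS.MemH1 f → (∀ x, f (-x) = f x) → DeltaNLS.proj 1 q f = 0 →
          DeltaNLS.h1NormSq f ≤ c₀ * DeltaNLS.LPairing 1 q f f := by
  -- Twice the half-line constant for `L₊`, because of the factor `1/2` in the form; `1/10` is the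
  -- range of `tanh a` allowed on the half-line.
  refine ⟨400000, by norm_num, 1 / 10, by norm_num, by norm_num, fun q hq f hf heven hP => ?_⟩
  have hq' := abs_lt.1 hq
  obtain ⟨h1, h2⟩ := DeltaNLS.omega_eq_zero_of_proj_eq_zero
    ⟨by linarith, by linarith⟩ hP
  rw [DeltaNLS.omega_ofReal hf.2.1 (DeltaNLS.memLp_dGroundState hq)] at h1
  rw [DeltaNLS.omega_I_mul_ofReal hf.2.1 (DeltaNLS.memLp_groundState hq), neg_eq_zero] at h2
  have hre := DeltaNLS.LPlusPairing_coercive hq (hf.clm_comp Complex.reCLM).1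
    (fun x => congrArg Complex.re (heven x)) h2
  have him := DeltaNLS.LMinusPairing_coercive hq (hf.clm_comp Complex.imCLM).1
    (fun x => congrArg Complex.im (heven x)) h1
  simp only [Complex.reCLM_apply, Complex.imCLM_apply] at hre him
  -- Nonnegativity allows the constant 6000 of `L₋` to be raised to the common 400000.
  have hnn : 0 ≤ DeltaNLS.LMinusPairing 1 q (fun x => (f x).im) (fun x => (f x).im) := by
    have e1 : 0 ≤ ∫ x, (f x).im ^ 2 := MeasureTheory.integral_nonneg fun x => sq_nonneg _
    have e2 : 0 ≤ ∫ x, DeltaNLS.weakDeriv (fun x => (f x).im) x ^ 2 :=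
      MeasureTheory.integral_nonneg fun x => sq_nonneg _
    linarith
  rw [DeltaNLS.h1NormSq_eq hf, DeltaNLS.LPairing]
  linarith
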